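/- Let $n\ge 2$ agents have values drawn independently from a distribution $F$ on $[0,1]$ with continuous c.d.f., and let $v(q)=F^{-1}(q)=\inf\{t: q\le F(t)\}$. For $0\le k\le n$, the highest-$k$-bids-win auction serves the $k$ highest bidders (ties broken uniformly at random); in quantile space its allocation rule is $$x_k(q)=\sum_{i=0}^{k-1}\binom{n-1}{i}q^{n-1-i}(1-q)^i ,$$ and its per-agent revenue is $P_k=\int_0^1 v(q)(1-q)\,x_k'(q)\,dq$. Let $x=\sum_{j=0}^n w_jx_j$ be a convex combination ($w_j\ge 0$, $\sum_j w_j=1$), and consider the all-pay auction (every agent pays her bid, bids are nonnegative) that runs the highest-$j$-bids-win auction with probability $w_j$. Let $s$ be a strategy such that all agents bidding by $s$ is a Bayes-Nash equilibrium of this auction. The bid distribution is the law of $s(V)$ with $V\sim F$. Given $N\ge1$ independent samples from the bid distribution, sorted as $b_{(1)}\le\dots\le b_{(N)}$, define the estimated bid function $\widehat b(q)=b_{(i)}$ for $q\in[\tfrac{i-1}{N},\tfrac iN)$, put $$Z_k(q)=\frac{(1-q)\,x_k'(q)}{x'(q)},$$ and let $\widehat P_k=\int_0^1 -Z_k'(q)\,\widehat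 b(q)\,dq$ be the plug-in estimate of $P_k$. Theorem. Let $1\le k\le n$ and suppose that $w_j>0$ for some $j$ with $1\le j\le k$ and $j<n$ (for $k<n$ this says exactly that $x'\not\equiv0$ and $Z_k(q)\to0$ as $q\to1$). Then for every $N\ge 1$ $$\mathbb E\bigl[|\widehat P_k-P_k|^2\bigr]^{1/2}\;\le\;\sqrt{\frac2N}\;\sup_{0<q<1}x'(q)\;\sup_{0<q<1}\frac{(1-q)\,x_k'(q)}{x'(q)} ,$$ where the right-hand side is $+\infty$ if the last supremum is infinite. -/

import Mathlib

open MeasureTheory ProbabilityTheory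
open scoped ENNReal

noncomputable section

namespace RankAuction

/-! ### The auction -/

/-- Highest-`k`-bids-win auction among `n` agents, ties broken uniformly at random: the probability
that agent `i` is served at the bid profile `β`. If `a` agents bid strictly more than agent `i` and
`t` agents (agent `i` included) bid the same, then the `(k - a)⁺` units that are left are
allotted uniformly at random among these `t` agents (at most one unit each). -/
def multiUnitAlloc {n : ℕ} (k : ℕ) (β : Fin n → ℝ) (i : Fin n) : ℝ :=
  min 1 (max 0 ((k : ℝ) - ((Finset.univ.filter fun j => β i < β j).card : ℝ)) /
    ((Finset.univ.filter fun j => β j = β i).card : ℝ))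

/-- The rank-based auction that runs the highest-`k`-bids-win auction with probability `w k`,
`k = 0, …, n`: the probability that agent `i` is served at the bid profile `β`. -/
def rankAlloc {n : ℕ} (w : Fin (n + 1) → ℝ) (β : Fin n → ℝ) (i : Fin n) : ℝ :=
  ∑ k : Fin (n + 1), w k * multiUnitAlloc k β i

/-- Interim allocation of agent `i` when bidding `z`, the others drawing their values independently
from `F` and bidding according to the strategy profile `σ`. -/
def interimAlloc {n : ℕ} (F : Measure ℝ) (w : Fin (n + 1) → ℝ) (σ : Fin n → ℝ → ℝ)
    (i : Fin n) (z : ℝ) : ℝ :=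
  ∫ V : Fin n → ℝ, rankAlloc w (Function.update (fun j => σ j (V j)) i z) i
    ∂(Measure.pi fun _ => F)

/-- Interim utility in the all-pay format (the bid is paid whether or not the agent is served)
of agent `i` with value `v` when bidding `z`. -/
def allPayUtility {n : ℕ} (F : Measure ℝ) (w : Fin (n + 1) → ℝ) (σ : Fin n → ℝ → ℝ)
    (i : Fin n) (v z : ℝ) : ℝ :=
  v * interimAlloc F w σ i z - z

/-- Bayes-Nash equilibrium of the all-pay rank-based auction with values in `[0, 1]`
and nonnegative bids. -/
structure IsAllPayBNE {n : ℕ} (F : Measure ℝ) (w : Fin (n + 1) → ℝ) (σ : Fin n → ℝ → ℝ) :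
    Prop where
  measurable : ∀ i, Measurable (σ i)
  nonneg : ∀ i, ∀ v ∈ Set.Icc (0 : ℝ) 1, 0 ≤ σ i v
  best_response : ∀ i, ∀ v ∈ Set.Icc (0 : ℝ) 1, ∀ z, 0 ≤ z →
    allPayUtility F w σ i v z ≤ allPayUtility F w σ i v (σ i v)

/-! ### Quantile space -/

/-- The value function `v(q) = F⁻¹(q)`. -/
def valueFn (F : Measure ℝ) (q : ℝ) : ℝ :=
  sInf {t : ℝ | q ≤ cdf F t}

/-- The revenue curve `R(q) = v(q) (1 - q)`. -/
def revenueCurve (F : Measure ℝ) (q : ℝ) : ℝ :=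
  valueFn F q * (1 - q)

/-- The per-agent revenue `E_q[R(q) x'(q)]` of an auction with allocation rule `x`
in quantile space. -/
def revenue (F : Measure ℝ) (x : ℝ → ℝ) : ℝ :=
  ∫ q in (0 : ℝ)..1, revenueCurve F q * deriv x q

/-- Allocation rule `x_k` in quantile space of the highest-`k`-bids-win auction for `n` agents: the
probability that at most `k - 1` of the other `n - 1` quantiles exceed `q`. -/
def multiUnitRule (n k : ℕ) (q : ℝ) : ℝ :=
  ∑ i ∈ Finset.range k, ((n - 1).choose i : ℝ) * q ^ (n - 1 - i) * (1 - q) ^ i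

/-- Allocation rule `x = ∑_k w_k x_k` in quantile space of the rank-based auction. -/
def rankRule {n : ℕ} (w : Fin (n + 1) → ℝ) (q : ℝ) : ℝ :=
  ∑ k : Fin (n + 1), w k * multiUnitRule n k q

/-- The per-agent revenue `P_k` of the highest-`k`-bids-win auction for `n` agents. -/
def multiUnitRevenue (F : Measure ℝ) (n k : ℕ) : ℝ :=
  revenue F (multiUnitRule n k)

/-! ### The estimator -/

/-- `Z_k(q) = (1 - q) x_k'(q) / x'(q)`. -/
def Z {n : ℕ} (w : Fin (n + 1) → ℝ) (k : ℕ) (q : ℝ) : ℝ :=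
  (1 - q) * deriv (multiUnitRule n k) q / deriv (rankRule w) q

/-- The estimated bid function: on `[(i - 1) / N, i / N)` it is the `i`-th smallest of the `N`
sampled bids (the value `0` at `q ≥ 1` is a convention). -/
def estBid {N : ℕ} (β : Fin N → ℝ) (q : ℝ) : ℝ :=
  if h : ⌊q * N⌋₊ < N then β (Tuple.sort β ⟨⌊q * N⌋₊, h⟩) else 0

/-- The plug-in estimate of `P_k` from the sampled bids `β`: the formula
`P_k = E_q[-Z_k'(q) b(q)]` with the bid function replaced by its estimate. -/
def estRevenue {n N : ℕ} (w : Fin (n + 1) → ℝ) (k : ℕ) (β : Fin N → ℝ) : ℝ :=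
  ∫ q in (0 : ℝ)..1, -deriv (Z w k) q * estBid β q

/-- The error `E[|Y - c|²]^{1/2}` of the estimator `Y` of the quantity `c`. -/
def rootMSE {Ω : Type*} [MeasurableSpace Ω] (P : Measure Ω) (Y : Ω → ℝ) (c : ℝ) : ℝ≥0∞ :=
  (∫⁻ ω, ENNReal.ofReal (|Y ω - c| ^ 2) ∂P) ^ (1 / 2 : ℝ)

end RankAuction

end

noncomputable section

namespace RankAuction

/-! ### Allocation rules in quantile space -/

/-! Equilibrium bids. Outbidding an atom of the bid distribution by an arbitrarily small amount
would be profitable, so ties have probability zero (`IsAllPayBNE.measure_eq_zero`). Bids are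
monotone in values, hence type `v` is served with probability `x(F(v))`, and the envelope formula
determines `s`. In quantile space the bid function is `b(q) = ∫₀^q v x'`, and bids are distributed
as `b(U)` with `U` uniform (`IsAllPayBNE.map_eq`). Since `0 ≤ v ≤ 1`, `b` is monotone and
`L`-Lipschitz for any bound `L` on `x'`.

Linear functional. Formally `v = b' / x'`, so `P_k = ∫ Z_k b'`, which equals `∫ -Z_k' b` because
`b(0) = 0` and `Z_k → 0` at `1` (`multiUnitRevenue_eq`). The error of the estimate is therefore `∫
-Z_k' (b̂ - b)`. Cauchy-Schwarz with weight `|Z_k'|` bounds its square by `(∫ |Z_k'|) · ∫ |Z_k'| (b̂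
- b)²`.

Two estimates finish the proof. Sorting commutes with the monotone `b`, so `E (b̂(q) - b(q))²` is at
most `L²` times the mean squared distance from `q` of a uniform order statistic, a beta variable;
this is at most `L² / (2N)` (`lintegral_sq_estBid_sub_le`). As a function of the odds `q / (1 - q)`,
the reciprocal of `Z_k` is, when `k < n`, a nonnegative combination of integer powers, hence convex;
so `Z_k` is quasiconcave and `∫ |Z_k'| ≤ 2M` whenever `Z_k ≤ M` (`lintegral_abs_deriv_Z_le`).
Together the mean squared error is at most `(2M)² L² / (2N) = 2 L² M² / N`. -/

theorem hasDerivAt_multiUnitRule (n k : ℕ) (q : ℝ) :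
    HasDerivAt (multiUnitRule n k)
      ((k * (n - 1).choose k : ℝ) * q ^ (n - 1 - k) * (1 - q) ^ (k - 1)) q := by
  generalize hm : n - 1 = m
  have key : HasDerivAt (fun q : ℝ => ∑ i ∈ Finset.range k, (m.choose i : ℝ) * q ^ (m - i) *
      (1 - q) ^ i) ((k * m.choose k : ℝ) * q ^ (m - k) * (1 - q) ^ (k - 1)) q := by
    induction k with
    | zero => simpa using hasDerivAt_const q (0 : ℝ)
    | succ k ih =>
      simp_rw [Finset.sum_range_succ]
      have h1 : HasDerivAt (fun q : ℝ => (m.choose k : ℝ) * q ^ (m - k) * (1 - q) ^ k)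
          ((m.choose k : ℝ) * ((m - k : ℕ) * q ^ (m - k - 1)) * (1 - q) ^ k +
            (m.choose k : ℝ) * q ^ (m - k) * (k * (1 - q) ^ (k - 1) * (-1))) q := by
        have ha : HasDerivAt (fun q : ℝ => (m.choose k : ℝ) * q ^ (m - k))
            ((m.choose k : ℝ) * ((m - k : ℕ) * q ^ (m - k - 1))) q :=
          (hasDerivAt_pow _ q).const_mul _
        have hb : HasDerivAt (fun q : ℝ => (1 - q) ^ k) (k * (1 - q) ^ (k - 1) * (-1)) q :=
          ((hasDerivAt_id q).const_sub 1).pow k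
        exact ha.mul hb
      -- The sum telescopes: differentiating the factor `(1 - q) ^ k` of the new term cancels the
      -- derivative of the earlier terms.
      refine (ih.add h1).congr_deriv ?_
      have hc : (m.choose (k + 1) : ℝ) * (k + 1) = m.choose k * (m - k : ℕ) := by
        exact_mod_cast Nat.choose_succ_right_eq m k
      have : m - (k + 1) = m - k - 1 := by omega
      rw [this]
      push_cast
      linear_combination (-q ^ (m - k - 1) * (1 - q) ^ k) * hc
  unfold multiUnitRule
  rw [hm]
  exact key

theorem deriv_multiUnitRule (n k : ℕ) (q : ℝ) :
    deriv (multiUnitRule n k) q =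
      (k * (n - 1).choose k : ℝ) * q ^ (n - 1 - k) * (1 - q) ^ (k - 1) :=
  (hasDerivAt_multiUnitRule n k q).deriv

theorem hasDerivAt_rankRule {n : ℕ} (w : Fin (n + 1) → ℝ) (q : ℝ) :
    HasDerivAt (rankRule w) (∑ j : Fin (n + 1), w j * deriv (multiUnitRule n j) q) q := by
  unfold rankRule
  refine HasDerivAt.fun_sum fun j _ => ?_
  exact ((hasDerivAt_multiUnitRule n j q).differentiableAt.hasDerivAt).const_mul _

theorem deriv_rankRule {n : ℕ} (w : Fin (n + 1) → ℝ) (q : ℝ) :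
    deriv (rankRule w) q = ∑ j : Fin (n + 1), w j * deriv (multiUnitRule n j) q :=
  (hasDerivAt_rankRule w q).deriv

theorem contDiff_deriv_multiUnitRule (n k : ℕ) : ContDiff ℝ 1 (deriv (multiUnitRule n k)) := by
  simp_rw [funext (deriv_multiUnitRule n k)]
  fun_prop

theorem contDiff_deriv_rankRule {n : ℕ} (w : Fin (n + 1) → ℝ) :
    ContDiff ℝ 1 (deriv (rankRule w)) := by
  simp_rw [funext (deriv_rankRule w)]
  exact ContDiff.sum fun j _ => contDiff_const.mul (contDiff_deriv_multiUnitRule n j)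

theorem deriv_multiUnitRule_nonneg (n k : ℕ) {q : ℝ} (hq : q ∈ Set.Icc (0 : ℝ) 1) :
    0 ≤ deriv (multiUnitRule n k) q := by
  rw [deriv_multiUnitRule]
  have := hq.1
  have : 0 ≤ 1 - q := sub_nonneg.2 hq.2
  positivity

theorem deriv_multiUnitRule_pos {n k : ℕ} (hk : 1 ≤ k) (hkn : k < n) {q : ℝ}
    (hq : q ∈ Set.Ioo (0 : ℝ) 1) : 0 < deriv (multiUnitRule n k) q := by
  rw [deriv_multiUnitRule]
  have := hq.1
  have : 0 < 1 - q := sub_pos.2 hq.2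
  have : 0 < (n - 1).choose k := Nat.choose_pos (by omega)
  positivity

theorem deriv_rankRule_nonneg {n : ℕ} {w : Fin (n + 1) → ℝ} (hw : ∀ j, 0 ≤ w j) {q : ℝ}
    (hq : q ∈ Set.Icc (0 : ℝ) 1) : 0 ≤ deriv (rankRule w) q := by
  rw [deriv_rankRule]
  exact Finset.sum_nonneg fun j _ => mul_nonneg (hw j) (deriv_multiUnitRule_nonneg n j hq)

theorem deriv_rankRule_pos {n : ℕ} {w : Fin (n + 1) → ℝ} (hw : ∀ j, 0 ≤ w j)
    {j : Fin (n + 1)} (hj : 1 ≤ (j : ℕ)) (hjn : (j : ℕ) < n) (hwj : 0 < w j) {q : ℝ}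
    (hq : q ∈ Set.Ioo (0 : ℝ) 1) : 0 < deriv (rankRule w) q := by
  rw [deriv_rankRule]
  refine (mul_pos hwj (deriv_multiUnitRule_pos hj hjn hq)).trans_le ?_
  exact Finset.single_le_sum (f := fun j : Fin (n + 1) => w j * deriv (multiUnitRule n j) q)
    (fun j _ => mul_nonneg (hw j) (deriv_multiUnitRule_nonneg n j (Set.Ioo_subset_Icc_self hq)))
    (Finset.mem_univ j)

theorem multiUnitRule_zero {N K : ℕ} (hK : K ≤ N) : multiUnitRule (N + 1) K 0 = 0 := by
  refine Finset.sum_eq_zero fun i hi => ?_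
  have : N - i ≠ 0 := by have := Finset.mem_range.1 hi; omega
  simp [this]

theorem multiUnitRule_one {n K : ℕ} (hK : 1 ≤ K) : multiUnitRule n K 1 = 1 := by
  unfold multiUnitRule
  rw [Finset.sum_eq_single 0]
  · simp
  · intro i _ hi
    simp [hi]
  · intro h
    simp at h
    omega

/-! ### Moments of the beta distribution with integer parameters -/

/-- Density of the `(N - K + 1)`-st smallest of `N` independent uniform samples. -/
def betaDensity (N K : ℕ) (t : ℝ) : ℝ :=
  (K * N.choose K : ℝ) * t ^ (N - K) * (1 - t) ^ (K - 1)

/-- On the unit interval, for `1 ≤ K ≤ N`, the allocation rule for `N + 1` agents is also the c.d.f.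
of an order statistic of `N` uniform samples. -/
theorem hasDerivAt_multiUnitRule_betaDensity (N K : ℕ) (t : ℝ) :
    HasDerivAt (multiUnitRule (N + 1) K) (betaDensity N K t) t :=
  hasDerivAt_multiUnitRule (N + 1) K t

theorem continuous_betaDensity (N K : ℕ) : Continuous (betaDensity N K) := by
  unfold betaDensity
  fun_prop

theorem integral_betaDensity {N K : ℕ} (hK : 1 ≤ K) (hKN : K ≤ N) :
    ∫ t in (0 : ℝ)..1, betaDensity N K t = 1 := by
  rw [intervalIntegral.integral_eq_sub_of_hasDerivAt
    (fun t _ => hasDerivAt_multiUnitRule_betaDensity N K t)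
    ((continuous_betaDensity N K).intervalIntegrable _ _), multiUnitRule_zero hKN,
    multiUnitRule_one hK, sub_zero]

/-- Multiplying by `t` only shifts a parameter of the density, so every moment reduces to a total
mass. -/
theorem mul_betaDensity {N K : ℕ} (hKN : K ≤ N) (t : ℝ) :
    t * betaDensity N K t = (N + 1 - K) / (N + 1) * betaDensity (N + 1) K t := by
  have h : (N.choose K : ℝ) * (N + 1) = (N + 1).choose K * (N + 1 - K) := by
    have := Nat.choose_mul_succ_eq N K
    have h2 : ((N + 1 - K : ℕ) : ℝ) = N + 1 - K := by rw [Nat.cast_sub (by omega)]; push_cast; ring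
    rw [← h2]
    exact_mod_cast this
  have e : N + 1 - K = N - K + 1 := by omega
  unfold betaDensity
  rw [e, pow_succ]
  have : (N + 1 : ℝ) ≠ 0 := by positivity
  field_simp
  linear_combination K * t * t ^ (N - K) * (1 - t) ^ (K - 1) * h

theorem integral_sub_sq_mul_betaDensity {N K : ℕ} (hK : 1 ≤ K) (hKN : K ≤ N) (q : ℝ) :
    ∫ t in (0 : ℝ)..1, (t - q) ^ 2 * betaDensity N K t =
      (N + 1 - K) / (N + 1) * ((N + 2 - K) / (N + 2)) - 2 * q * ((N + 1 - K) / (N + 1)) + q ^ 2 := by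
  have h : ∀ t : ℝ, (t - q) ^ 2 * betaDensity N K t =
      (N + 1 - K) / (N + 1) * ((N + 2 - K) / (N + 2)) * betaDensity (N + 2) K t
        - 2 * q * ((N + 1 - K) / (N + 1)) * betaDensity (N + 1) K t
        + q ^ 2 * betaDensity N K t := by
    intro t
    have h1 := mul_betaDensity hKN t
    have h2 := mul_betaDensity (N := N + 1) (by omega : K ≤ N + 1) t
    push_cast at h2
    have e1 : (N : ℝ) + 1 + 1 = N + 2 := by ring
    rw [e1] at h2
    linear_combination (t - 2 * q) * h1 + (N + 1 - K) / (N + 1) * h2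
  have hi : ∀ (c : ℝ) (N : ℕ), IntervalIntegrable (fun t => c * betaDensity N K t) volume 0 1 :=
    fun c N => ((continuous_betaDensity N K).intervalIntegrable _ _).const_mul c
  simp_rw [h]
  rw [intervalIntegral.integral_add ((hi _ _).sub (hi _ _)) (hi _ _),
    intervalIntegral.integral_sub (hi _ _) (hi _ _)]
  simp_rw [intervalIntegral.integral_const_mul]
  rw [integral_betaDensity hK hKN, integral_betaDensity hK (by omega : K ≤ N + 1),
    integral_betaDensity hK (by omega : K ≤ N + 2)]
  ring

theorem beta_sq_error_le {N i : ℕ} (hi : i < N) {q : ℝ} (hq : (i : ℝ) ≤ q * N)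
    (hq' : q * N ≤ i + 1) :
    ((i : ℝ) + 1) / (N + 1) * ((i + 2) / (N + 2)) - 2 * q * ((i + 1) / (N + 1)) + q ^ 2
      ≤ 1 / (2 * N) := by
  have hiN : (i : ℝ) + 1 ≤ N := by exact_mod_cast hi
  have hi0 : (0 : ℝ) ≤ i := Nat.cast_nonneg i
  have hN : (1 : ℝ) ≤ N := by linarith
  generalize (i : ℝ) = a at *
  generalize (N : ℝ) = m at *
  -- Variance plus squared bias; each is at most `1 / (4 * m)`.
  have e : (a + 1) / (m + 1) * ((a + 2) / (m + 2)) - 2 * q * ((a + 1) / (m + 1)) + q ^ 2 =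
      (a + 1) * (m - a) / ((m + 1) ^ 2 * (m + 2)) + ((a + 1) / (m + 1) - q) ^ 2 := by
    field_simp
    ring
  have h1 : (a + 1) * (m - a) / ((m + 1) ^ 2 * (m + 2)) ≤ 1 / (4 * m) := by
    rw [div_le_div_iff₀ (by positivity) (by positivity)]
    have : 4 * ((a + 1) * (m - a)) ≤ (m + 1) ^ 2 := by nlinarith [sq_nonneg (a + 1 - (m - a))]
    nlinarith [mul_le_mul_of_nonneg_right this (by linarith : 0 ≤ m), sq_nonneg (m + 1)]
  have h2 : ((a + 1) / (m + 1) - q) ^ 2 ≤ 1 / (4 * m) := by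
    have hle : |(a + 1) / (m + 1) - q| ≤ 1 / (m + 1) := by
      have e3 : (a + 1) / (m + 1) - q = ((a + 1) - q * (m + 1)) / (m + 1) := by field_simp
      rw [e3, abs_div, abs_of_pos (by linarith : 0 < m + 1)]
      gcongr
      have hq0 : 0 ≤ q := by
        by_contra h
        nlinarith
      have hq1 : q ≤ 1 := by
        by_contra h
        nlinarith
      -- The numerator is `(a + 1 - q * m) - q`, a difference of two numbers in `[0, 1]`.
      rw [abs_le]
      constructor <;> nlinarith
    calc ((a + 1) / (m + 1) - q) ^ 2 = |(a + 1) / (m + 1) - q| ^ 2 := (sq_abs _).symm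
      _ ≤ (1 / (m + 1)) ^ 2 := by gcongr
      _ ≤ 1 / (4 * m) := by
        rw [div_pow, div_le_div_iff₀ (by positivity) (by positivity)]
        nlinarith [sq_nonneg (m - 1)]
  rw [e]
  calc _ ≤ 1 / (4 * m) + 1 / (4 * m) := add_le_add h1 h2
    _ = 1 / (2 * m) := by field_simp; norm_num

/-! ### Binomial counts and order statistics -/

/-- The event is a box; coordinates outside `T` are unconstrained. -/
theorem measureReal_pi_filter_eq {ι α : Type*} [Fintype ι] [DecidableEq ι] [MeasurableSpace α]
    (μ : Measure α) [IsProbabilityMeasure μ] (p : α → Prop) [DecidablePred p]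
    {S T : Finset ι} (hST : S ⊆ T) :
    (Measure.pi fun _ : ι => μ).real {ω | T.filter (fun j => p (ω j)) = S} =
      μ.real {x | p x} ^ S.card * μ.real {x | ¬ p x} ^ (T.card - S.card) := by
  have h : {ω : ι → α | T.filter (fun j => p (ω j)) = S} =
      Set.univ.pi fun j => if j ∈ S then {x | p x} else if j ∈ T then {x | ¬ p x} else Set.univ := by
    ext ω
    simp only [Set.mem_ofPred_eq, Set.mem_pi, Set.mem_univ, true_implies, Finset.ext_iff,
      Finset.mem_filter]
    refine forall_congr' fun j => ?_
    by_cases hS : j ∈ S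
    · simp [hS, hST hS]
    · by_cases hT : j ∈ T <;> simp [hS, hT]
  rw [h, Measure.real, Measure.pi_pi, ENNReal.toReal_prod]
  have h2 : ∀ j : ι, (μ (if j ∈ S then {x | p x} else if j ∈ T then {x | ¬ p x} else Set.univ)).toReal
      = (if j ∈ S then μ.real {x | p x} else 1) * (if j ∈ T \ S then μ.real {x | ¬ p x} else 1) := by
    intro j
    by_cases hS : j ∈ S
    · simp [hS, Measure.real]
    · by_cases hT : j ∈ T <;> simp [hS, hT, Measure.real]
  simp_rw [h2]
  rw [Finset.prod_mul_distrib, Finset.prod_ite_mem, Finset.prod_ite_mem]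
  simp [Finset.card_sdiff_of_subset hST]

theorem measurableSet_filter_eq {ι α : Type*} [Fintype ι] [DecidableEq ι] [MeasurableSpace α]
    {p : α → Prop} [DecidablePred p] (hp : MeasurableSet {x | p x}) (T S : Finset ι) :
    MeasurableSet {ω : ι → α | T.filter (fun j => p (ω j)) = S} := by
  simp only [Finset.ext_iff, Finset.mem_filter, Set.ofPred_forall]
  refine MeasurableSet.iInter fun j => ?_
  have h1 : MeasurableSet {ω : ι → α | p (ω j)} := measurable_pi_apply j hp
  have h2 : MeasurableSet {ω : ι → α | ¬ p (ω j)} := h1.compl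
  by_cases hT : j ∈ T <;> by_cases hS : j ∈ S <;> simp only [hT, hS, true_and, false_and,
    iff_true, iff_false, Set.ofPred_true, Set.ofPred_false, MeasurableSet.univ,
    MeasurableSet.empty, h1, h2]

/-- A binomial tail, obtained by grouping the possible sets of successes by cardinality. It gives
both the law of uniform order statistics and the equilibrium allocation. -/
theorem measureReal_pi_card_lt {ι α : Type*} [Fintype ι] [DecidableEq ι] [MeasurableSpace α]
    (μ : Measure α) [IsProbabilityMeasure μ] {p : α → Prop} [DecidablePred p]
    (hp : MeasurableSet {x | p x}) (T : Finset ι) (k : ℕ) :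
    (Measure.pi fun _ : ι => μ).real {ω | (T.filter fun j => p (ω j)).card < k} =
      multiUnitRule (T.card + 1) k (μ.real {x | ¬ p x}) := by
  have hq : 1 - μ.real {x | ¬ p x} = μ.real {x | p x} := by
    have := probReal_compl_eq_one_sub (μ := μ) hp
    rw [show {x | ¬ p x} = {x | p x}ᶜ from rfl, this]
    ring
  unfold multiUnitRule
  rw [hq]
  have h : {ω : ι → α | (T.filter fun j => p (ω j)).card < k} =
      ⋃ S ∈ T.powerset.filter (fun S => S.card < k), {ω | T.filter (fun j => p (ω j)) = S} := by
    ext ω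
    simp [Finset.filter_subset]
  rw [h, measureReal_biUnion_finset]
  · rw [← Finset.sum_fiberwise_of_maps_to (s := T.powerset.filter (fun S => S.card < k))
      (t := Finset.range k) (g := Finset.card) (by simp)]
    refine Finset.sum_congr rfl fun m hm => ?_
    have hf : (T.powerset.filter (fun S => S.card < k)).filter (fun S => S.card = m) =
        Finset.powersetCard m T := by
      ext S
      have := Finset.mem_range.1 hm
      simp only [Finset.mem_filter, Finset.mem_powerset, Finset.mem_powersetCard]
      grind
    rw [hf]
    have : ∀ S ∈ Finset.powersetCard m T,
        (Measure.pi fun _ : ι => μ).real {ω | T.filter (fun j => p (ω j)) = S} =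
          μ.real {x | p x} ^ m * μ.real {x | ¬ p x} ^ (T.card - m) := by
      intro S hS
      obtain ⟨h1, h2⟩ := Finset.mem_powersetCard.1 hS
      rw [measureReal_pi_filter_eq μ p h1, h2]
    rw [Finset.sum_congr rfl this, Finset.sum_const, Finset.card_powersetCard, nsmul_eq_mul]
    simp only [Nat.add_sub_cancel]
    ring
  · intro S _ S' _ hne
    refine Set.disjoint_left.2 fun ω h1 h2 => hne ?_
    exact h1.symm.trans h2
  · intro S _
    exact measurableSet_filter_eq hp T S

/-- The `(i + 1)`-st smallest entry of a tuple. -/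
def orderStat {N : ℕ} (i : Fin N) (β : Fin N → ℝ) : ℝ :=
  β (Tuple.sort β i)

theorem orderStat_le_iff {N : ℕ} (i : Fin N) (β : Fin N → ℝ) (t : ℝ) :
    orderStat i β ≤ t ↔ (Finset.univ.filter fun j => t < β j).card < N - i := by
  have h1 := Tuple.lt_card_le_iff_apply_le_of_monotone (j := i) (a := t) (Tuple.monotone_sort β)
  have h2 : (Finset.univ.filter fun j => (β ∘ Tuple.sort β) j ≤ t).card =
      (Finset.univ.filter fun j => β j ≤ t).card :=
    Finset.card_equiv (Tuple.sort β) (by simp)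
  have h3 := Finset.card_filter_add_card_filter_not (s := Finset.univ) (fun j => β j ≤ t)
  simp only [not_le, Finset.card_univ, Fintype.card_fin] at h3
  rw [h2] at h1
  rw [orderStat, ← Function.comp_apply (f := β), ← h1]
  have := i.2
  omega

/-- The permutation sorting `β` also puts `b ∘ β` in order. New ties may change the chosen
permutation, but not the sorted tuple. -/
theorem orderStat_comp {N : ℕ} (i : Fin N) {β : Fin N → ℝ} {b : ℝ → ℝ} {s : Set ℝ}
    (hb : MonotoneOn b s) (hβ : ∀ j, β j ∈ s) :
    orderStat i (fun j => b (β j)) = b (orderStat i β) := by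
  have h : Monotone ((b ∘ β) ∘ Tuple.sort β) := fun j j' hj =>
    hb (hβ _) (hβ _) (Tuple.monotone_sort β hj)
  exact (congrFun (Tuple.comp_sort_eq_comp_iff_monotone.2 h) i).symm

theorem measurable_orderStat {N : ℕ} (i : Fin N) : Measurable (orderStat i) := by
  refine measurable_of_Iic fun t => ?_
  have : orderStat i ⁻¹' Set.Iic t =
      ⋃ S ∈ {S : Finset (Fin N) | S.card < N - i},
        {β : Fin N → ℝ | Finset.univ.filter (fun j => t < β j) = S} := by
    ext β
    simp [orderStat_le_iff]
  rw [this]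
  exact MeasurableSet.biUnion (Set.to_countable _) fun S _ =>
    measurableSet_filter_eq measurableSet_Ioi _ S

/-- The uniform distribution on the unit interval. -/
def unif : Measure ℝ := volume.restrict (Set.Ioc 0 1)

instance : IsProbabilityMeasure unif := ⟨by simp [unif]⟩

theorem unif_real_Iic {t : ℝ} (ht : t ∈ Set.Icc (0 : ℝ) 1) : unif.real (Set.Iic t) = t := by
  rw [unif, measureReal_restrict_apply measurableSet_Iic, Set.inter_comm, Set.Ioc_inter_Iic,
    min_eq_right ht.2]
  simp [ht.1]

theorem Ioc_zero_one_inter_Iic (t : ℝ) :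
    Set.Ioc (0 : ℝ) 1 ∩ Set.Iic t = Set.Ioc 0 (max 0 (min 1 t)) := by
  rw [Set.Ioc_inter_Iic]
  rcases le_total 0 (min 1 t) with h | h
  · rw [max_eq_right h]
  · rw [max_eq_left h, Set.Ioc_self, Set.Ioc_eq_empty (not_lt.2 h)]

theorem map_orderStat {N : ℕ} (i : Fin N) :
    (Measure.pi fun _ : Fin N => unif).map (orderStat i) =
      unif.withDensity fun t => ENNReal.ofReal (betaDensity N (N - i) t) := by
  have hK : 1 ≤ N - (i : ℕ) := by have := i.2; omega
  have : IsProbabilityMeasure ((Measure.pi fun _ : Fin N => unif).map (orderStat i)) :=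
    Measure.isProbabilityMeasure_map (measurable_orderStat i).aemeasurable
  refine Measure.ext_of_Iic _ _ fun t => ?_
  -- Clamping `t` to the unit interval treats all real `t` at once.
  set τ : ℝ := max 0 (min 1 t) with hτ
  have hτ01 : τ ∈ Set.Icc (0 : ℝ) 1 := ⟨le_max_left _ _, max_le zero_le_one (min_le_left _ _)⟩
  have hl : (Measure.pi fun _ : Fin N => unif).map (orderStat i) (Set.Iic t) =
      ENNReal.ofReal (multiUnitRule (N + 1) (N - i) τ) := by
    rw [Measure.map_apply (measurable_orderStat i) measurableSet_Iic]
    have h := measureReal_pi_card_lt (ι := Fin N) unif (p := fun x => t < x) measurableSet_Ioi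
      Finset.univ (N - i)
    have hs : orderStat i ⁻¹' Set.Iic t =
      {β : Fin N → ℝ | (Finset.univ.filter fun j => t < β j).card < N - i} := by
      ext β
      simp [orderStat_le_iff]
    have hu : unif.real {x | ¬ t < x} = τ := by
      have : {x | ¬ t < x} = Set.Iic t := by ext; simp
      rw [this, unif, measureReal_restrict_apply measurableSet_Iic, Set.inter_comm,
        Ioc_zero_one_inter_Iic, ← hτ]
      simp [hτ01.1]
    rw [hs, ← ofReal_measureReal, h, hu]
    simp
  rw [hl, withDensity_apply _ measurableSet_Iic, unif, Measure.restrict_restrict measurableSet_Iic,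
    Set.inter_comm, Ioc_zero_one_inter_Iic, ← hτ]
  rw [← ofReal_integral_eq_lintegral_ofReal]
  · rw [← intervalIntegral.integral_of_le hτ01.1, intervalIntegral.integral_eq_sub_of_hasDerivAt
      (fun t _ => hasDerivAt_multiUnitRule_betaDensity N (N - i) t)
      ((continuous_betaDensity N (N - i)).intervalIntegrable _ _), multiUnitRule_zero (by omega),
      sub_zero]
  · exact ((continuous_betaDensity N (N - i)).intervalIntegrable 0 τ).1
  · refine (ae_restrict_iff' measurableSet_Ioc).2 (Filter.Eventually.of_forall fun t ht => ?_)
    have : 0 ≤ t := ht.1.le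
    have : 0 ≤ 1 - t := sub_nonneg.2 (ht.2.trans hτ01.2)
    simp only [Pi.zero_apply, betaDensity]
    positivity

theorem betaDensity_nonneg (N K : ℕ) {t : ℝ} (ht : t ∈ Set.Icc (0 : ℝ) 1) :
    0 ≤ betaDensity N K t := by
  have := ht.1
  have : 0 ≤ 1 - t := sub_nonneg.2 ht.2
  unfold betaDensity
  positivity

theorem lintegral_sq_orderStat_sub_le {N : ℕ} (i : Fin N) {q : ℝ} (hq : (i : ℝ) ≤ q * N)
    (hq' : q * N ≤ i + 1) :
    ∫⁻ U, ENNReal.ofReal ((orderStat i U - q) ^ 2) ∂(Measure.pi fun _ : Fin N => unif) ≤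
      ENNReal.ofReal (1 / (2 * N)) := by
  have hK : 1 ≤ N - (i : ℕ) := by have := i.2; omega
  have hm : Measurable fun t : ℝ => ENNReal.ofReal ((t - q) ^ 2) := by fun_prop
  have hcont := continuous_betaDensity N (N - i)
  rw [← lintegral_map hm (measurable_orderStat i), map_orderStat,
    lintegral_withDensity_eq_lintegral_mul _ (by fun_prop) hm]
  have h : ∫⁻ t, ((fun t => ENNReal.ofReal (betaDensity N (N - i) t)) *
      fun t => ENNReal.ofReal ((t - q) ^ 2)) t ∂unif =
      ENNReal.ofReal (∫ t in (0 : ℝ)..1, (t - q) ^ 2 * betaDensity N (N - i) t) := by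
    rw [intervalIntegral.integral_of_le zero_le_one, ofReal_integral_eq_lintegral_ofReal]
    · refine setLIntegral_congr_fun measurableSet_Ioc fun t ht => ?_
      simp only [Pi.mul_apply]
      rw [mul_comm, ENNReal.ofReal_mul (sq_nonneg _)]
    · exact (Continuous.intervalIntegrable (by fun_prop) 0 1).1
    · exact (ae_restrict_iff' measurableSet_Ioc).2 (Filter.Eventually.of_forall fun t ht =>
        mul_nonneg (sq_nonneg _) (betaDensity_nonneg _ _ ⟨ht.1.le, ht.2⟩))
  rw [h, integral_sub_sq_mul_betaDensity hK (by omega)]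
  refine ENNReal.ofReal_le_ofReal ?_
  have hc : ((N - (i : ℕ) : ℕ) : ℝ) = N - i := by rw [Nat.cast_sub i.2.le]
  refine le_trans (le_of_eq ?_) (beta_sq_error_le i.2 hq hq')
  rw [hc]
  ring

/-! ### Total variation of quasiconcave functions -/

/-- A quasiconcave function rises up to a maximizer `c` and falls afterwards, so its variation is `2
f(c) - f(a) - f(b)`. -/
theorem integral_abs_deriv_le_of_quasiconcave {f : ℝ → ℝ} {s : Set ℝ} {M : ℝ} (hs : IsOpen s)
    (hf : ContDiffOn ℝ 1 f s) (h0 : ∀ x ∈ s, 0 ≤ f x) (hM : ∀ x ∈ s, f x ≤ M)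
    (hquasi : ∀ x ∈ s, ∀ z ∈ s, ∀ y ∈ Set.Icc x z, min (f x) (f z) ≤ f y)
    {a b : ℝ} (hab : a ≤ b) (hsub : Set.Icc a b ⊆ s) :
    ∫ x in a..b, |deriv f x| ≤ 2 * M := by
  obtain ⟨c, hc, hmax⟩ := isCompact_Icc.exists_isMaxOn (Set.nonempty_Icc.2 hab)
    (hf.continuousOn.mono hsub)
  have hdiff : ∀ x ∈ s, DifferentiableAt ℝ f x := fun x hx =>
    (hf.differentiableOn one_ne_zero).differentiableAt (hs.mem_nhds hx)
  have hcont : ContinuousOn (deriv f) s := hf.continuousOn_deriv_of_isOpen hs le_rfl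
  have hmono : MonotoneOn f (Set.Icc a c) := by
    intro x hx y hy hxy
    have hxs : x ∈ Set.Icc a b := ⟨hx.1, hx.2.trans hc.2⟩
    have := hquasi x (hsub hxs) c (hsub hc) y ⟨hxy, hy.2⟩
    rwa [min_eq_left (hmax hxs)] at this
  have hanti : AntitoneOn f (Set.Icc c b) := by
    intro x hx y hy hxy
    have hys : y ∈ Set.Icc a b := ⟨hc.1.trans hy.1, hy.2⟩
    have := hquasi c (hsub hc) y (hsub hys) x ⟨hx.1, hxy⟩
    rwa [min_eq_right (hmax hys)] at this
  have hint : ∀ {u v : ℝ}, a ≤ u → u ≤ v → v ≤ b → IntervalIntegrable (deriv f) volume u v := by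
    intro u v hau huv hvb
    refine (hcont.mono ?_).intervalIntegrable
    rw [Set.uIcc_of_le huv]
    exact (Set.Icc_subset_Icc hau hvb).trans hsub
  have hFTC : ∀ {u v : ℝ}, a ≤ u → u ≤ v → v ≤ b → ∫ x in u..v, deriv f x = f v - f u := by
    intro u v hau huv hvb
    refine intervalIntegral.integral_eq_sub_of_hasDerivAt (fun x hx => ?_) (hint hau huv hvb)
    rw [Set.uIcc_of_le huv] at hx
    exact (hdiff x (hsub ⟨hau.trans hx.1, hx.2.trans hvb⟩)).hasDerivAt
  have h1 : ∫ x in a..c, |deriv f x| = f c - f a := by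
    rw [← hFTC le_rfl hc.1 hc.2]
    refine intervalIntegral.integral_congr_Ioo_of_le hc.1 fun x hx => abs_of_nonneg ?_
    rw [← derivWithin_of_mem_nhds (Icc_mem_nhds hx.1 hx.2)]
    exact hmono.derivWithin_nonneg
  have h2 : ∫ x in c..b, |deriv f x| = f c - f b := by
    rw [← neg_sub, ← hFTC hc.1 hc.2 le_rfl, ← intervalIntegral.integral_neg]
    refine intervalIntegral.integral_congr_Ioo_of_le hc.2 fun x hx => abs_of_nonpos ?_
    rw [← derivWithin_of_mem_nhds (Icc_mem_nhds hx.1 hx.2)]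
    exact hanti.derivWithin_nonpos
  rw [← intervalIntegral.integral_add_adjacent_intervals (hint le_rfl hc.1 hc.2).abs
    (hint hc.1 hc.2 le_rfl).abs, h1, h2]
  have := hM c (hsub hc)
  have := h0 a (hsub ⟨le_rfl, hab⟩)
  have := h0 b (hsub ⟨hab, le_rfl⟩)
  linarith

theorem lintegral_abs_deriv_le_of_quasiconcave {f : ℝ → ℝ} {M : ℝ}
    (hf : ContDiffOn ℝ 1 f (Set.Ioo 0 1)) (h0 : ∀ x ∈ Set.Ioo (0 : ℝ) 1, 0 ≤ f x)
    (hM : ∀ x ∈ Set.Ioo (0 : ℝ) 1, f x ≤ M)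
    (hquasi : ∀ x ∈ Set.Ioo (0 : ℝ) 1, ∀ z ∈ Set.Ioo (0 : ℝ) 1, ∀ y ∈ Set.Icc x z,
      min (f x) (f z) ≤ f y) :
    ∫⁻ q, ENNReal.ofReal |deriv f q| ∂unif ≤ ENNReal.ofReal (2 * M) := by
  -- The derivative is not controlled at the endpoints, so `(0, 1)` is exhausted by compact
  -- intervals. The shift by `2` makes them nonempty already for `m = 0`.
  have hε : Filter.Tendsto (fun m : ℕ => 1 / ((m : ℝ) + 2)) Filter.atTop (nhds 0) := by
    have := tendsto_one_div_add_atTop_nhds_zero_nat (𝕜 := ℝ)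
    refine ((Filter.tendsto_add_atTop_iff_nat 1).2 this).congr fun m => ?_
    push_cast
    congr 1
    ring
  have hε2 : Filter.Tendsto (fun m : ℕ => 1 - 1 / ((m : ℝ) + 2)) Filter.atTop (nhds 1) := by
    simpa using hε.const_sub 1
  have hcov := aecover_Ioc_of_Icc (μ := volume) hε hε2
  have hlim := hcov.lintegral_tendsto_of_countably_generated
    (f := fun q => ENNReal.ofReal |deriv f q|) (by fun_prop)
  refine le_of_tendsto' hlim fun m => ?_
  have hm : (0 : ℝ) < m + 2 := by positivity
  have hm1 : 1 / ((m : ℝ) + 2) ≤ 1 / 2 := by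
    apply one_div_le_one_div_of_le <;> linarith [(Nat.cast_nonneg m : (0 : ℝ) ≤ m)]
  have hm0 : 0 < 1 / ((m : ℝ) + 2) := by positivity
  have hsub : Set.Icc (1 / ((m : ℝ) + 2)) (1 - 1 / ((m : ℝ) + 2)) ⊆ Set.Ioo 0 1 :=
    fun x hx => ⟨by linarith [hx.1], by linarith [hx.2]⟩
  have hle : 1 / ((m : ℝ) + 2) ≤ 1 - 1 / ((m : ℝ) + 2) := by linarith
  have hcont : ContinuousOn (deriv f) (Set.Ioo 0 1) :=
    hf.continuousOn_deriv_of_isOpen isOpen_Ioo le_rfl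
  calc ∫⁻ q in Set.Icc (1 / ((m : ℝ) + 2)) (1 - 1 / ((m : ℝ) + 2)),
        ENNReal.ofReal |deriv f q| ∂(volume.restrict (Set.Ioc 0 1))
      ≤ ∫⁻ q in Set.Icc (1 / ((m : ℝ) + 2)) (1 - 1 / ((m : ℝ) + 2)),
        ENNReal.ofReal |deriv f q| :=
        lintegral_mono' (Measure.restrict_mono_measure Measure.restrict_le_self _) le_rfl
    _ = ENNReal.ofReal (∫ q in (1 / ((m : ℝ) + 2))..(1 - 1 / ((m : ℝ) + 2)), |deriv f q|) := by
        rw [intervalIntegral.integral_of_le hle, ← integral_Icc_eq_integral_Ioc,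
          ofReal_integral_eq_lintegral_ofReal]
        · exact ((hcont.mono hsub).abs).integrableOn_compact isCompact_Icc
        · exact Filter.Eventually.of_forall fun x => abs_nonneg _
    _ ≤ ENNReal.ofReal (2 * M) := ENNReal.ofReal_le_ofReal
        (integral_abs_deriv_le_of_quasiconcave isOpen_Ioo hf h0 hM hquasi hle hsub)

/-! ### The weight function `Z` -/

/-- Up to a constant factor, the reciprocal of `Z` as a function of the odds `q / (1 - q)`. -/
def recipZ {n : ℕ} (w : Fin (n + 1) → ℝ) (k : ℕ) (r : ℝ) : ℝ :=
  ∑ j : Fin (n + 1), w j * ((j : ℕ) * (n - 1).choose j : ℝ) *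
    (r ^ ((k : ℤ) - (j : ℕ)) + r ^ ((k : ℤ) - (j : ℕ) + 1))

section Weight

variable {n : ℕ} {w : Fin (n + 1) → ℝ}

/-- Integer powers, of either sign, are convex on the positive half-line. -/
theorem convexOn_recipZ (hw : ∀ j, 0 ≤ w j) (k : ℕ) :
    ConvexOn ℝ (Set.Ioi 0) (recipZ w k) := by
  have : recipZ w k = ∑ j : Fin (n + 1), fun r : ℝ => w j * ((j : ℕ) * (n - 1).choose j : ℝ) *
    (r ^ ((k : ℤ) - (j : ℕ)) + r ^ ((k : ℤ) - (j : ℕ) + 1)) := by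
    ext r
    simp [recipZ]
  rw [this]
  refine Finset.sum_induction _ (ConvexOn ℝ (Set.Ioi 0)) (fun _ _ h h' => h.add h')
    (convexOn_const 0 (convex_Ioi 0)) fun j _ => ?_
  exact ((convexOn_zpow _).add (convexOn_zpow _)).smul
    (mul_nonneg (hw j) (by positivity : (0 : ℝ) ≤ (j : ℕ) * (n - 1).choose j))

theorem le_recipZ (hw : ∀ j, 0 ≤ w j) (k : ℕ) (j : Fin (n + 1)) {r : ℝ} (hr : 0 < r) :
    w j * ((j : ℕ) * (n - 1).choose j : ℝ) * (r ^ ((k : ℤ) - (j : ℕ)) + r ^ ((k : ℤ) - (j : ℕ) + 1))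
      ≤ recipZ w k r := by
  refine Finset.single_le_sum (f := fun j : Fin (n + 1) => w j * ((j : ℕ) * (n - 1).choose j : ℝ) *
    (r ^ ((k : ℤ) - (j : ℕ)) + r ^ ((k : ℤ) - (j : ℕ) + 1))) (fun j _ => ?_) (Finset.mem_univ j)
  have := hw j
  positivity

theorem recipZ_pos (hw : ∀ j, 0 ≤ w j) {j : Fin (n + 1)} (hj : 1 ≤ (j : ℕ)) (hjn : (j : ℕ) < n)
    (hwj : 0 < w j) (k : ℕ) {r : ℝ} (hr : 0 < r) : 0 < recipZ w k r := by
  refine lt_of_lt_of_le ?_ (le_recipZ hw k j hr)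
  have : 0 < (n - 1).choose j := Nat.choose_pos (by omega)
  positivity

/-- With `r = q / (1 - q)`, the ratio `x_j' / x_k'` is a constant times `r ^ (k - j)`, and `1 / (1 -
q) = 1 + r` yields the two powers in `recipZ`. The product form also covers `k = n`, where `x_k' =
0`. -/
theorem mul_deriv_multiUnitRule_mul_recipZ (k : ℕ) {q : ℝ} (hq : q ∈ Set.Ioo (0 : ℝ) 1) :
    (1 - q) * deriv (multiUnitRule n k) q * recipZ w k (q / (1 - q)) =
      (k * (n - 1).choose k : ℝ) * deriv (rankRule w) q := by
  have hq0 : q ≠ 0 := hq.1.ne'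
  have hq1 : 1 - q ≠ 0 := (sub_pos.2 hq.2).ne'
  -- Truncated subtraction is harmless: the coefficient vanishes for `i = 0` and for `i > n - 1`.
  have hpow : ∀ i : ℕ, (i * (n - 1).choose i : ℝ) * q ^ (n - 1 - i) * (1 - q) ^ (i - 1) =
      (i * (n - 1).choose i : ℝ) * (q ^ (n - 1) / q ^ i * ((1 - q) ^ i / (1 - q))) := by
    intro i
    by_cases hi : n - 1 < i
    · simp [Nat.choose_eq_zero_of_lt hi]
    · rcases Nat.eq_zero_or_pos i with rfl | h0
      · simp
      · rw [pow_sub₀ q hq0 (by omega : i ≤ n - 1), ← pow_sub_one_mul h0.ne' (1 - q)]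
        field_simp
  rw [deriv_rankRule, recipZ, Finset.mul_sum, Finset.mul_sum]
  refine Finset.sum_congr rfl fun j _ => ?_
  rw [deriv_multiUnitRule, deriv_multiUnitRule, hpow, hpow]
  have hr : q / (1 - q) ≠ 0 := div_ne_zero hq0 hq1
  rw [zpow_add_one₀ hr, zpow_sub₀ hr, zpow_natCast, zpow_natCast, div_pow, div_pow]
  field_simp
  ring

theorem Z_eq (hw : ∀ j, 0 ≤ w j) {j : Fin (n + 1)} (hj : 1 ≤ (j : ℕ)) (hjn : (j : ℕ) < n)
    (hwj : 0 < w j) (k : ℕ) {q : ℝ} (hq : q ∈ Set.Ioo (0 : ℝ) 1) :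
    Z w k q = (k * (n - 1).choose k : ℝ) / recipZ w k (q / (1 - q)) := by
  have hr : 0 < q / (1 - q) := div_pos hq.1 (sub_pos.2 hq.2)
  rw [Z, div_eq_div_iff (deriv_rankRule_pos hw hj hjn hwj hq).ne' (recipZ_pos hw hj hjn hwj k hr).ne']
  exact mul_deriv_multiUnitRule_mul_recipZ k hq

theorem Z_nonneg (hw : ∀ j, 0 ≤ w j) (k : ℕ) {q : ℝ} (hq : q ∈ Set.Icc (0 : ℝ) 1) :
    0 ≤ Z w k q :=
  div_nonneg (mul_nonneg (sub_nonneg.2 hq.2) (deriv_multiUnitRule_nonneg n k hq))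
    (deriv_rankRule_nonneg hw hq)

theorem odds_mono {x y : ℝ} (hxy : x ≤ y) (hy : y < 1) : x / (1 - x) ≤ y / (1 - y) := by
  rw [div_le_div_iff₀ (by linarith) (by linarith)]
  nlinarith

/-- The reciprocal of a positive convex function is quasiconcave, and the increasing change of
variable to odds preserves this. -/
theorem min_Z_le (hw : ∀ j, 0 ≤ w j) {j : Fin (n + 1)} (hj : 1 ≤ (j : ℕ)) (hjn : (j : ℕ) < n)
    (hwj : 0 < w j) (k : ℕ) {x y z : ℝ} (hx : x ∈ Set.Ioo (0 : ℝ) 1) (hz : z ∈ Set.Ioo (0 : ℝ) 1)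
    (hy : y ∈ Set.Icc x z) : min (Z w k x) (Z w k z) ≤ Z w k y := by
  have hy' : y ∈ Set.Ioo (0 : ℝ) 1 := ⟨hx.1.trans_le hy.1, hy.2.trans_lt hz.2⟩
  have hpos : ∀ {u : ℝ}, u ∈ Set.Ioo (0 : ℝ) 1 → 0 < u / (1 - u) :=
    fun hu => div_pos hu.1 (sub_pos.2 hu.2)
  rw [Z_eq hw hj hjn hwj k hx, Z_eq hw hj hjn hwj k hy', Z_eq hw hj hjn hwj k hz]
  have h := (convexOn_recipZ hw k).le_max_of_mem_Icc (hpos hx) (hpos hz)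
    ⟨odds_mono hy.1 hy'.2, odds_mono hy.2 hz.2⟩
  have hc : (0 : ℝ) ≤ k * (n - 1).choose k := by positivity
  have hG := recipZ_pos hw hj hjn hwj k (hpos hy')
  rcases le_max_iff.1 h with h | h
  · exact (min_le_left _ _).trans (div_le_div_of_nonneg_left hc hG h)
  · exact (min_le_right _ _).trans (div_le_div_of_nonneg_left hc hG h)

theorem contDiffOn_Z (hw : ∀ j, 0 ≤ w j) {j : Fin (n + 1)} (hj : 1 ≤ (j : ℕ)) (hjn : (j : ℕ) < n)
    (hwj : 0 < w j) (k : ℕ) : ContDiffOn ℝ 1 (Z w k) (Set.Ioo 0 1) := by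
  refine ContDiffOn.div ?_ (contDiff_deriv_rankRule w).contDiffOn fun q hq =>
    (deriv_rankRule_pos hw hj hjn hwj hq).ne'
  exact ((contDiff_const.sub contDiff_id).mul (contDiff_deriv_multiUnitRule n k)).contDiffOn

/-- Since `j ≤ k`, the `j`-th term of `recipZ` grows at least linearly in the odds, which tend to
infinity. -/
theorem tendsto_Z_one (hw : ∀ j, 0 ≤ w j) {j : Fin (n + 1)} (hj : 1 ≤ (j : ℕ)) (hjn : (j : ℕ) < n)
    (hwj : 0 < w j) {k : ℕ} (hjk : (j : ℕ) ≤ k) :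
    Filter.Tendsto (Z w k) (nhdsWithin 1 (Set.Iio 1)) (nhds 0) := by
  set a : ℝ := w j * ((j : ℕ) * (n - 1).choose j : ℝ) with ha
  have hapos : 0 < a := by
    have : 0 < (n - 1).choose j := Nat.choose_pos (by omega)
    positivity
  have hmem : ∀ᶠ q : ℝ in nhdsWithin 1 (Set.Iio 1), q ∈ Set.Ioo (1 / 2 : ℝ) 1 :=
    Ioo_mem_nhdsLT (by norm_num)
  have hlim : Filter.Tendsto (fun q : ℝ => (k * (n - 1).choose k : ℝ) / a * (2 * (1 - q)))
      (nhdsWithin 1 (Set.Iio 1)) (nhds 0) := by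
    have : Continuous fun q : ℝ => (k * (n - 1).choose k : ℝ) / a * (2 * (1 - q)) := by fun_prop
    have h := this.tendsto 1
    simp only [sub_self, mul_zero] at h
    exact h.mono_left nhdsWithin_le_nhds
  refine squeeze_zero' (hmem.mono fun q hq => Z_nonneg hw k ⟨by linarith [hq.1], hq.2.le⟩)
    (hmem.mono fun q hq => ?_) hlim
  have hq' : q ∈ Set.Ioo (0 : ℝ) 1 := ⟨by linarith [hq.1], hq.2⟩
  have h1q : 0 < 1 - q := sub_pos.2 hq.2
  have hr : 0 < q / (1 - q) := div_pos hq'.1 h1q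
  have hr1 : 1 ≤ q / (1 - q) := by
    rw [le_div_iff₀ h1q]
    linarith [hq.1]
  have hG : a * (q / (1 - q)) ≤ recipZ w k (q / (1 - q)) := by
    refine le_trans ?_ (le_recipZ hw k j hr)
    refine mul_le_mul_of_nonneg_left ?_ hapos.le
    rw [zpow_add_one₀ hr.ne']
    have : 1 ≤ (q / (1 - q)) ^ ((k : ℤ) - (j : ℕ)) := one_le_zpow₀ hr1 (by omega)
    nlinarith
  rw [Z_eq hw hj hjn hwj k hq']
  calc (k * (n - 1).choose k : ℝ) / recipZ w k (q / (1 - q))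
      ≤ (k * (n - 1).choose k : ℝ) / (a * (q / (1 - q))) :=
        div_le_div_of_nonneg_left (by positivity) (by positivity) hG
    _ = (k * (n - 1).choose k : ℝ) / a * ((1 - q) / q) := by
        have := hq'.1.ne'
        field_simp
    _ ≤ (k * (n - 1).choose k : ℝ) / a * (2 * (1 - q)) := by
        refine mul_le_mul_of_nonneg_left ?_ (by positivity)
        rw [div_le_iff₀ hq'.1]
        nlinarith [hq.1]

theorem lintegral_abs_deriv_Z_le (hw : ∀ j, 0 ≤ w j) {j : Fin (n + 1)} (hj : 1 ≤ (j : ℕ))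
    (hjn : (j : ℕ) < n) (hwj : 0 < w j) (k : ℕ) {M : ℝ}
    (hM : ∀ q ∈ Set.Ioo (0 : ℝ) 1, Z w k q ≤ M) :
    ∫⁻ q, ENNReal.ofReal |deriv (Z w k) q| ∂unif ≤ ENNReal.ofReal (2 * M) :=
  lintegral_abs_deriv_le_of_quasiconcave (contDiffOn_Z hw hj hjn hwj k)
    (fun _ hq => Z_nonneg hw k (Set.Ioo_subset_Icc_self hq)) hM
    fun _ hx _ hz _ hy => min_Z_le hw hj hjn hwj k hx hz hy

theorem integrable_deriv_Z (hw : ∀ j, 0 ≤ w j) {j : Fin (n + 1)} (hj : 1 ≤ (j : ℕ))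
    (hjn : (j : ℕ) < n) (hwj : 0 < w j) (k : ℕ) {M : ℝ}
    (hM : ∀ q ∈ Set.Ioo (0 : ℝ) 1, Z w k q ≤ M) : Integrable (deriv (Z w k)) unif := by
  refine ⟨(measurable_deriv _).aestronglyMeasurable, ?_⟩
  rw [hasFiniteIntegral_iff_norm]
  exact (lintegral_abs_deriv_Z_le hw hj hjn hwj k hM).trans_lt ENNReal.ofReal_lt_top

theorem integral_deriv_Z (hw : ∀ j, 0 ≤ w j) {j : Fin (n + 1)} (hj : 1 ≤ (j : ℕ))
    (hjn : (j : ℕ) < n) (hwj : 0 < w j) {k : ℕ} (hjk : (j : ℕ) ≤ k) {M : ℝ}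
    (hM : ∀ q ∈ Set.Ioo (0 : ℝ) 1, Z w k q ≤ M) {q : ℝ} (hq : q ∈ Set.Ioo (0 : ℝ) 1) :
    ∫ r in q..1, deriv (Z w k) r = -Z w k q := by
  have hdiff : ∀ x ∈ Set.Ioo (0 : ℝ) 1, DifferentiableAt ℝ (Z w k) x := fun x hx =>
    ((contDiffOn_Z hw hj hjn hwj k).differentiableOn one_ne_zero).differentiableAt
      (isOpen_Ioo.mem_nhds hx)
  have hint : IntervalIntegrable (deriv (Z w k)) volume q 1 := by
    rw [intervalIntegrable_iff_integrableOn_Ioc_of_le hq.2.le]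
    exact IntegrableOn.mono_set (integrable_deriv_Z hw hj hjn hwj k hM)
      (Set.Ioc_subset_Ioc_left hq.1.le)
  rw [intervalIntegral.integral_eq_sub_of_hasDerivAt_of_tendsto hq.2
    (fun x hx => (hdiff x ⟨hq.1.trans hx.1, hx.2⟩).hasDerivAt) hint
    ((hdiff q hq).continuousAt.tendsto.mono_left nhdsWithin_le_nhds)
    (tendsto_Z_one hw hj hjn hwj hjk), zero_sub]

end Weight

/-! ### Allocation as a function of the own bid -/

section Alloc

variable {n : ℕ}

theorem multiUnitAlloc_update (k : ℕ) (β : Fin n → ℝ) (i : Fin n) (z : ℝ) :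
    multiUnitAlloc k (Function.update β i z) i =
      min 1 (max 0 ((k : ℝ) - (((Finset.univ.erase i).filter fun j => z < β j).card : ℝ)) /
        ((((Finset.univ.erase i).filter fun j => β j = z).card : ℝ) + 1)) := by
  have h1 : (Finset.univ.filter fun j => Function.update β i z i < Function.update β i z j) =
      (Finset.univ.erase i).filter fun j => z < β j := by
    ext j
    by_cases hj : j = i
    · subst hj; simp
    · simp [hj]
  have h2 : (Finset.univ.filter fun j => Function.update β i z j = Function.update β i z i) =
      insert i ((Finset.univ.erase i).filter fun j => β j = z) := by
    ext j
    by_cases hj : j = i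
    · subst hj; simp
    · simp [hj]
  rw [multiUnitAlloc, h1, h2, Finset.card_insert_of_notMem (by simp)]
  push_cast
  rfl

theorem multiUnitAlloc_nonneg (k : ℕ) (β : Fin n → ℝ) (i : Fin n) : 0 ≤ multiUnitAlloc k β i :=
  le_min zero_le_one (by positivity)

theorem multiUnitAlloc_le_one (k : ℕ) (β : Fin n → ℝ) (i : Fin n) : multiUnitAlloc k β i ≤ 1 :=
  min_le_left _ _

/-- If fewer than `k` opponents bid above `z`, then fewer than `k` bid at least `z' > z`, so `z'`
wins for sure; otherwise `z` wins nothing. -/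
theorem multiUnitAlloc_update_mono (k : ℕ) (β : Fin n → ℝ) (i : Fin n) :
    Monotone fun z => multiUnitAlloc k (Function.update β i z) i := by
  intro z z' hz
  rcases hz.eq_or_lt with rfl | hz
  · rfl
  dsimp only
  rw [multiUnitAlloc_update k β i z]
  rcases Nat.lt_or_ge ((Finset.univ.erase i).filter fun j => z < β j).card k with hk | hk
  · refine (min_le_left _ _).trans ?_
    rw [multiUnitAlloc_update]
    refine le_min le_rfl ?_
    have hcard : ((Finset.univ.erase i).filter fun j => z' < β j).card +
        ((Finset.univ.erase i).filter fun j => β j = z').card ≤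
        ((Finset.univ.erase i).filter fun j => z < β j).card := by
      rw [← Finset.card_union_of_disjoint]
      · refine Finset.card_le_card fun j => ?_
        simp only [Finset.mem_union, Finset.mem_filter]
        rintro (⟨h1, h2⟩ | ⟨h1, h2⟩)
        · exact ⟨h1, hz.trans h2⟩
        · exact ⟨h1, h2 ▸ hz⟩
      · refine Finset.disjoint_left.2 fun j h1 h2 => ?_
        simp only [Finset.mem_filter] at h1 h2
        exact h1.2.ne' h2.2
    rw [le_div_iff₀ (by positivity), one_mul]
    refine le_max_of_le_right ?_
    have : (((Finset.univ.erase i).filter fun j => z' < β j).card : ℝ) +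
        ((Finset.univ.erase i).filter fun j => β j = z').card + 1 ≤ k := by
      exact_mod_cast (by omega)
    linarith
  · have hk' : (k : ℝ) - ((Finset.univ.erase i).filter fun j => z < β j).card ≤ 0 :=
      sub_nonpos.2 (by exact_mod_cast hk)
    rw [max_eq_left hk', zero_div]
    exact (min_le_right _ _).trans (multiUnitAlloc_nonneg _ _ _)

theorem multiUnitAlloc_update_of_forall_ne (k : ℕ) {β : Fin n → ℝ} {i : Fin n} {z : ℝ}
    (h : ∀ j, j ≠ i → β j ≠ z) :
    multiUnitAlloc k (Function.update β i z) i =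
      if ((Finset.univ.erase i).filter fun j => z < β j).card < k then 1 else 0 := by
  rw [multiUnitAlloc_update]
  have h0 : ((Finset.univ.erase i).filter fun j => β j = z) = ∅ :=
    Finset.filter_eq_empty_iff.2 fun j hj => h j (Finset.ne_of_mem_erase hj)
  rw [h0]
  simp only [Finset.card_empty, Nat.cast_zero, zero_add, div_one]
  split_ifs with hk
  · refine min_eq_left (le_max_of_le_right ?_)
    have : (((Finset.univ.erase i).filter fun j => z < β j).card : ℝ) + 1 ≤ k := by
      exact_mod_cast hk
    linarith
  · rw [max_eq_left, min_eq_right zero_le_one]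
    exact sub_nonpos.2 (by exact_mod_cast not_lt.1 hk)

theorem multiUnitAlloc_update_of_forall_eq (k : ℕ) {β : Fin n → ℝ} {i : Fin n} {z : ℝ}
    (h : ∀ j, j ≠ i → β j = z) :
    multiUnitAlloc k (Function.update β i z) i = min 1 ((k : ℝ) / n) := by
  rw [multiUnitAlloc_update]
  have h0 : ((Finset.univ.erase i).filter fun j => β j = z) = Finset.univ.erase i :=
    Finset.filter_eq_self.2 fun j hj => h j (Finset.ne_of_mem_erase hj)
  have h1 : ((Finset.univ.erase i).filter fun j => z < β j) = ∅ :=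
    Finset.filter_eq_empty_iff.2 fun j hj => (h j (Finset.ne_of_mem_erase hj)).not_gt
  have h2 := Finset.card_erase_add_one (Finset.mem_univ i)
  rw [Finset.card_univ, Fintype.card_fin] at h2
  have h3 : ((Finset.univ.erase i).card : ℝ) + 1 = n := by exact_mod_cast h2
  rw [h0, h1, h3]
  simp

theorem rankAlloc_update_mono {w : Fin (n + 1) → ℝ} (hw : ∀ j, 0 ≤ w j) (β : Fin n → ℝ)
    (i : Fin n) : Monotone fun z => rankAlloc w (Function.update β i z) i := fun _ _ hz =>
  Finset.sum_le_sum fun k _ =>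
    mul_le_mul_of_nonneg_left (multiUnitAlloc_update_mono k β i hz) (hw k)

/-- Outbidding a profile of equal bids by any amount raises the allocation by a fixed amount. -/
theorem rankAlloc_gap {w : Fin (n + 1) → ℝ} (hw : ∀ j, 0 ≤ w j) {j : Fin (n + 1)}
    (hj : 1 ≤ (j : ℕ)) {β : Fin n → ℝ} {i : Fin n} {z z' : ℝ}
    (hz : z < z') (h : ∀ l, l ≠ i → β l = z) :
    rankAlloc w (Function.update β i z) i + w j * (1 - (j : ℕ) / n) ≤
      rankAlloc w (Function.update β i z') i := by
  -- Every auction in the mixture gains weakly, so the gain in the `j`-unit auction alone is a lower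
  -- bound.
  have hle : w j * multiUnitAlloc j (Function.update β i z') i -
      w j * multiUnitAlloc j (Function.update β i z) i ≤
      ∑ k : Fin (n + 1), (w k * multiUnitAlloc k (Function.update β i z') i -
        w k * multiUnitAlloc k (Function.update β i z) i) :=
    Finset.single_le_sum (f := fun k : Fin (n + 1) =>
        w k * multiUnitAlloc k (Function.update β i z') i -
        w k * multiUnitAlloc k (Function.update β i z) i)
      (fun k _ => sub_nonneg.2
        (mul_le_mul_of_nonneg_left (multiUnitAlloc_update_mono k β i hz.le) (hw k)))
      (Finset.mem_univ j)
  rw [Finset.sum_sub_distrib] at hle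
  have h1 : multiUnitAlloc j (Function.update β i z') i = 1 := by
    rw [multiUnitAlloc_update_of_forall_ne _ fun l hl => (h l hl).trans_ne hz.ne]
    have : ((Finset.univ.erase i).filter fun l => z' < β l) = ∅ :=
      Finset.filter_eq_empty_iff.2 fun l hl => by
        rw [h l (Finset.ne_of_mem_erase hl)]
        exact hz.not_gt
    rw [this, Finset.card_empty, if_pos (by omega)]
  have h2 : multiUnitAlloc j (Function.update β i z) i ≤ (j : ℕ) / n := by
    rw [multiUnitAlloc_update_of_forall_eq _ h]
    exact min_le_right _ _
  rw [h1] at hle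
  have h3 := mul_le_mul_of_nonneg_left h2 (hw j)
  unfold rankAlloc
  linarith

theorem measurable_card_filter {ι α : Type*} [MeasurableSpace α] (T : Finset ι)
    {p : ι → α → Prop} [∀ j a, Decidable (p j a)] (hp : ∀ j, MeasurableSet {a | p j a}) :
    Measurable fun a => ((T.filter fun j => p j a).card : ℝ) := by
  simp_rw [Finset.card_filter, Nat.cast_sum, Nat.cast_ite, Nat.cast_one, Nat.cast_zero]
  exact Finset.measurable_fun_sum _ fun j _ => Measurable.ite (hp j) measurable_const
    measurable_const

theorem measurable_multiUnitAlloc_update {s : ℝ → ℝ} (hs : Measurable s) (k : ℕ) (i : Fin n)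
    (z : ℝ) :
    Measurable fun V : Fin n → ℝ => multiUnitAlloc k (Function.update (fun j => s (V j)) i z) i := by
  simp_rw [multiUnitAlloc_update]
  have hm : ∀ j : Fin n, Measurable fun V : Fin n → ℝ => s (V j) :=
    fun j => hs.comp (measurable_pi_apply j)
  have h1 : Measurable fun V : Fin n → ℝ =>
      (((Finset.univ.erase i).filter fun j => z < s (V j)).card : ℝ) :=
    measurable_card_filter _ fun j => measurableSet_lt measurable_const (hm j)
  have h2 : Measurable fun V : Fin n → ℝ =>
      (((Finset.univ.erase i).filter fun j => s (V j) = z).card : ℝ) :=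
    measurable_card_filter _ fun j => measurableSet_eq_fun (hm j) measurable_const
  exact measurable_const.min
    ((measurable_const.max (measurable_const.sub h1)).div (h2.add measurable_const))

theorem integrable_multiUnitAlloc_update (F : Measure ℝ) [IsProbabilityMeasure F] {s : ℝ → ℝ}
    (hs : Measurable s) (k : ℕ) (i : Fin n) (z : ℝ) :
    Integrable (fun V : Fin n → ℝ => multiUnitAlloc k (Function.update (fun j => s (V j)) i z) i)
      (Measure.pi fun _ => F) := by
  refine Integrable.of_bound (measurable_multiUnitAlloc_update hs k i z).aestronglyMeasurable 1
    (Filter.Eventually.of_forall fun V => ?_)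
  rw [Real.norm_eq_abs, abs_of_nonneg (multiUnitAlloc_nonneg _ _ _)]
  exact multiUnitAlloc_le_one _ _ _

theorem integrable_rankAlloc_update (F : Measure ℝ) [IsProbabilityMeasure F]
    (w : Fin (n + 1) → ℝ) {s : ℝ → ℝ} (hs : Measurable s) (i : Fin n) (z : ℝ) :
    Integrable (fun V : Fin n → ℝ => rankAlloc w (Function.update (fun j => s (V j)) i z) i)
      (Measure.pi fun _ => F) :=
  integrable_finsetSum _ fun k _ => (integrable_multiUnitAlloc_update F hs k i z).const_mul _

theorem interimAlloc_mono (F : Measure ℝ) [IsProbabilityMeasure F] {w : Fin (n + 1) → ℝ}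
    (hw : ∀ j, 0 ≤ w j) {s : ℝ → ℝ} (hs : Measurable s) (i : Fin n) :
    Monotone (interimAlloc F w (fun _ => s) i) := fun z z' hz =>
  integral_mono (integrable_rankAlloc_update F w hs i z) (integrable_rankAlloc_update F w hs i z')
    fun _ => rankAlloc_update_mono hw _ i hz

/-- The gap of `rankAlloc_gap` occurs on the event that all `n - 1` opponents bid exactly `z`;
elsewhere monotonicity suffices. The gain does not depend on `z'`. -/
theorem interimAlloc_gap (F : Measure ℝ) [IsProbabilityMeasure F] {w : Fin (n + 1) → ℝ}
    (hw : ∀ j, 0 ≤ w j) {j : Fin (n + 1)} (hj : 1 ≤ (j : ℕ)) {s : ℝ → ℝ} (hs : Measurable s)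
    (i : Fin n) {z z' : ℝ} (hz : z < z') :
    interimAlloc F w (fun _ => s) i z +
        F.real {t | s t = z} ^ (n - 1) * (w j * (1 - (j : ℕ) / n)) ≤
      interimAlloc F w (fun _ => s) i z' := by
  set E : Set (Fin n → ℝ) :=
    {V | (Finset.univ.erase i).filter (fun l => s (V l) = z) = Finset.univ.erase i} with hE
  have hp : MeasurableSet {t | s t = z} := measurableSet_eq_fun hs measurable_const
  have hEm : MeasurableSet E := measurableSet_filter_eq hp _ _
  have hPE : (Measure.pi fun _ : Fin n => F).real E = F.real {t | s t = z} ^ (n - 1) := by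
    rw [hE, measureReal_pi_filter_eq F (fun t => s t = z) (Finset.Subset.refl _)]
    simp
  rw [← hPE, ← smul_eq_mul (Measure.real _ _), ← integral_indicator_const _ hEm, interimAlloc, interimAlloc,
    ← integral_add (integrable_rankAlloc_update F w hs i z)
      ((integrable_const _).indicator hEm)]
  refine integral_mono ((integrable_rankAlloc_update F w hs i z).add
    ((integrable_const _).indicator hEm)) (integrable_rankAlloc_update F w hs i z') fun V => ?_
  by_cases hV : V ∈ E
  · simp only [Set.indicator_of_mem hV]
    refine rankAlloc_gap hw hj hz fun l hl => ?_
    exact Finset.filter_eq_self.1 hV l (Finset.mem_erase.2 ⟨hl, Finset.mem_univ l⟩)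
  · simp only [Set.indicator_of_notMem hV, add_zero]
    exact rankAlloc_update_mono hw _ i hz.le

end Alloc

/-! ### Characterization of the symmetric equilibrium -/

theorem measure_singleton_of_continuous_cdf {F : Measure ℝ} [IsProbabilityMeasure F]
    (hF : Continuous (cdf F)) (a : ℝ) : F {a} = 0 := by
  rw [← measure_cdf F, StieltjesFunction.measure_singleton,
    (hF.continuousAt.continuousWithinAt).leftLim_eq, sub_self, ENNReal.ofReal_zero]

/-- Subgradient inequalities with continuous subgradients determine the derivative. -/
theorem eq_add_integral_of_subgradient {u X : ℝ → ℝ} {a b : ℝ} (hX : Continuous X)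
    (hu : ∀ v ∈ Set.Icc a b, ∀ v' ∈ Set.Icc a b, X v * (v' - v) ≤ u v' - u v) {v : ℝ}
    (hv : v ∈ Set.Icc a b) : u v = u a + ∫ t in a..v, X t := by
  have hderiv : ∀ v ∈ Set.Icc a b, HasDerivWithinAt u (X v) (Set.Icc a b) v := by
    intro v hv
    rw [hasDerivWithinAt_iff_isLittleO, Asymptotics.isLittleO_iff]
    intro c hc
    have h1 : ∀ᶠ v' in nhdsWithin v (Set.Icc a b), |X v' - X v| < c := by
      have := (Metric.tendsto_nhds.1 (hX.tendsto v)) c hc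
      exact nhdsWithin_le_nhds this
    filter_upwards [h1, self_mem_nhdsWithin] with v' hc' hv'
    have h2 := hu v hv v' hv'
    have h3 := hu v' hv' v hv
    simp only [smul_eq_mul, Real.norm_eq_abs]
    -- The inequalities at `v` and `v'` place the remainder between `0` and `(X v' - X v) * (v' -
    -- v)`.
    have h4 : |u v' - u v - (v' - v) * X v| ≤ |X v' - X v| * |v' - v| := by
      rw [abs_of_nonneg (by linarith), ← abs_mul]
      refine le_trans ?_ (le_abs_self _)
      linarith
    exact h4.trans (mul_le_mul_of_nonneg_right hc'.le (abs_nonneg _))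
  have h := intervalIntegral.integral_eq_sub_of_hasDerivAt_of_le hv.1 (f := u) (f' := X)
    (fun x hx => ((hderiv x ⟨hx.1, hx.2.trans hv.2⟩).continuousWithinAt).mono
      (Set.Icc_subset_Icc_right hv.2))
    (fun x hx => (hderiv x ⟨hx.1.le, hx.2.le.trans hv.2⟩).hasDerivAt
      (Icc_mem_nhds hx.1 (hx.2.trans_le hv.2)))
    (hX.intervalIntegrable _ _)
  linarith

section Equilibrium

variable {F : Measure ℝ} [IsProbabilityMeasure F] {n : ℕ} {w : Fin (n + 1) → ℝ} {s : ℝ → ℝ}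

/-- If a lower type bid strictly more, the two incentive constraints and monotone allocation would
force equal allocations at both bids, and the larger bid would be wasteful. -/
theorem IsAllPayBNE.monotoneOn (hs : IsAllPayBNE F w fun _ : Fin n => s) (hw : ∀ j, 0 ≤ w j)
    (i : Fin n) : MonotoneOn s (Set.Icc 0 1) := by
  intro v hv v' hv' hvv'
  rcases hvv'.eq_or_lt with rfl | hlt
  · rfl
  by_contra hcon
  have hcon := not_le.1 hcon
  have h1 := hs.best_response i v hv (s v') (hs.nonneg i v' hv')
  have h2 := hs.best_response i v' hv' (s v) (hs.nonneg i v hv)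
  have h3 := interimAlloc_mono F hw (hs.measurable i) i hcon.le
  unfold allPayUtility at h1 h2
  have h4 : interimAlloc F w (fun _ => s) i (s v) ≤ interimAlloc F w (fun _ => s) i (s v') := by
    by_contra h
    nlinarith
  have h5 := le_antisymm h3 h4
  rw [h5] at h1
  linarith

/-- At an atom `z`, a type `v > 0` bidding `z` could raise its bid by `v * δ / 2` and gain at least
`v * δ` in expected value. -/
theorem IsAllPayBNE.measure_eq_zero (hs : IsAllPayBNE F w fun _ : Fin n => s)
    (hF_supp : F (Set.Icc 0 1) = 1) (hF_cont : Continuous (cdf F)) (hw : ∀ j, 0 ≤ w j)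
    {j : Fin (n + 1)} (hj : 1 ≤ (j : ℕ)) (hjn : (j : ℕ) < n) (hwj : 0 < w j) (i : Fin n) (z : ℝ) :
    F {t | s t = z} = 0 := by
  by_contra hne
  -- The value `0` is discarded, being a null set, because the deviating type must have positive
  -- value.
  have hsupp : F (Set.Ioc 0 1)ᶜ = 0 := by
    rw [prob_compl_eq_zero_iff measurableSet_Ioc, ← hF_supp, ← Set.Icc_sdiff_left,
      measure_sdiff_null (measure_singleton_of_continuous_cdf hF_cont 0)]
  have hnonempty : ({t | s t = z} ∩ Set.Ioc 0 1).Nonempty := by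
    apply nonempty_of_measure_ne_zero (μ := F)
    rwa [measure_inter_conull hsupp]
  obtain ⟨v, hvz, hv⟩ := hnonempty
  have hvI : v ∈ Set.Icc (0 : ℝ) 1 := Set.Ioc_subset_Icc_self hv
  have hz0 : 0 ≤ z := by
    have := hs.nonneg i v hvI
    rwa [show s v = z from hvz] at this
  have hp : 0 < F.real {t | s t = z} := ENNReal.toReal_pos hne (measure_ne_top _ _)
  set δ := F.real {t | s t = z} ^ (n - 1) * (w j * (1 - (j : ℕ) / n)) with hδ
  have hδpos : 0 < δ := by
    have hn : (0 : ℝ) < n := by exact_mod_cast (by omega : 0 < n)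
    have : 0 < 1 - ((j : ℕ) : ℝ) / n := by
      rw [sub_pos, div_lt_one hn]
      exact_mod_cast hjn
    positivity
  have hvδ : 0 < v * δ := mul_pos hv.1 hδpos
  have h1 := interimAlloc_gap F hw hj (hs.measurable i) i
    (show z < z + v * δ / 2 by linarith)
  have h2 := hs.best_response i v hvI (z + v * δ / 2) (by linarith)
  unfold allPayUtility at h2
  rw [show s v = z from hvz] at h2
  nlinarith [mul_le_mul_of_nonneg_left h1 hv.1.le]

/-- Almost surely no opponent ties with `s v`, so by monotonicity ranking bids is ranking values,
and the count of higher values is binomial. -/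
theorem IsAllPayBNE.interimAlloc_eq (hs : IsAllPayBNE F w fun _ : Fin n => s)
    (hF_supp : F (Set.Icc 0 1) = 1) (hF_cont : Continuous (cdf F)) (hw : ∀ j, 0 ≤ w j)
    {j : Fin (n + 1)} (hj : 1 ≤ (j : ℕ)) (hjn : (j : ℕ) < n) (hwj : 0 < w j) (i : Fin n) {v : ℝ}
    (hv : v ∈ Set.Icc (0 : ℝ) 1) :
    interimAlloc F w (fun _ => s) i (s v) = rankRule w (cdf F v) := by
  have hmono := hs.monotoneOn hw i
  have hae : ∀ l : Fin n, ∀ᵐ V : Fin n → ℝ ∂(Measure.pi fun _ => F),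
      V l ∈ Set.Icc (0 : ℝ) 1 ∧ s (V l) ≠ s v := by
    intro l
    have h1 : ∀ᵐ t ∂F, t ∈ Set.Icc (0 : ℝ) 1 ∧ s t ≠ s v := by
      refine Filter.Eventually.and ?_ ?_
      · exact (prob_compl_eq_zero_iff measurableSet_Icc).2 hF_supp
      · rw [ae_iff]
        simpa using hs.measure_eq_zero hF_supp hF_cont hw hj hjn hwj i (s v)
    exact (measurePreserving_eval (fun _ : Fin n => F) l).quasiMeasurePreserving.ae h1
  have hae' := eventually_countable_forall.2 hae
  have hint : ∀ k : Fin (n + 1), ∫ V : Fin n → ℝ,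
      multiUnitAlloc k (Function.update (fun j => s (V j)) i (s v)) i ∂(Measure.pi fun _ => F) =
        multiUnitRule n k (cdf F v) := by
    intro k
    have hset : MeasurableSet
        {V : Fin n → ℝ | ((Finset.univ.erase i).filter fun l => v < V l).card < (k : ℕ)} := by
      have hm : Measurable fun V : Fin n → ℝ =>
          (((Finset.univ.erase i).filter fun l => v < V l).card : ℝ) :=
        measurable_card_filter _ fun l => measurableSet_lt measurable_const (measurable_pi_apply l)
      have := measurableSet_lt hm (measurable_const (a := ((k : ℕ) : ℝ)))
      simpa only [Nat.cast_lt] using this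
    have hcongr : (fun V : Fin n → ℝ =>
        multiUnitAlloc k (Function.update (fun j => s (V j)) i (s v)) i) =ᵐ[Measure.pi fun _ => F]
        {V : Fin n → ℝ | ((Finset.univ.erase i).filter fun l => v < V l).card < (k : ℕ)}.indicator
          fun _ => (1 : ℝ) := by
      filter_upwards [hae'] with V hV
      rw [multiUnitAlloc_update_of_forall_ne _ fun l _ => (hV l).2]
      have : ∀ l, s v < s (V l) ↔ v < V l := by
        intro l
        constructor
        · intro h
          by_contra h'
          exact (hmono (hV l).1 hv (not_lt.1 h')).not_gt h
        · intro h
          exact lt_of_le_of_ne (hmono hv (hV l).1 h.le) (hV l).2.symm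
      simp_rw [this]
      simp [Set.indicator_apply]
    rw [integral_congr_ae hcongr, integral_indicator_const _ hset, smul_eq_mul, mul_one,
      measureReal_pi_card_lt F (p := fun t => v < t) measurableSet_Ioi]
    have hcard : (Finset.univ.erase i).card + 1 = n := by
      rw [Finset.card_erase_add_one (Finset.mem_univ i), Finset.card_univ, Fintype.card_fin]
    have hset2 : {t | ¬ v < t} = Set.Iic v := by ext; simp
    rw [hcard, hset2, cdf_eq_real]
  unfold interimAlloc rankAlloc rankRule
  refine (integral_finsetSum _ fun (k : Fin (n + 1)) _ =>
    (integrable_multiUnitAlloc_update F (hs.measurable i) k i (s v)).const_mul (w k)).trans ?_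
  simp_rw [integral_const_mul, hint]

/-- Revenue equivalence: the equilibrium bids are determined by the allocation rule. -/
theorem IsAllPayBNE.bid_eq (hs : IsAllPayBNE F w fun _ : Fin n => s)
    (hF_supp : F (Set.Icc 0 1) = 1) (hF_cont : Continuous (cdf F)) (hw : ∀ j, 0 ≤ w j)
    {j : Fin (n + 1)} (hj : 1 ≤ (j : ℕ)) (hjn : (j : ℕ) < n) (hwj : 0 < w j) {v : ℝ}
    (hv : v ∈ Set.Icc (0 : ℝ) 1) :
    s v = ∫ t in (0 : ℝ)..v, (rankRule w (cdf F v) - rankRule w (cdf F t)) := by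
  let i : Fin n := ⟨0, by omega⟩
  have hX : Continuous fun t => rankRule w (cdf F t) :=
    (continuous_iff_continuousAt.2 fun q => (hasDerivAt_rankRule w q).continuousAt).comp hF_cont
  have halloc := fun {v : ℝ} (hv : v ∈ Set.Icc (0 : ℝ) 1) =>
    hs.interimAlloc_eq hF_supp hF_cont hw hj hjn hwj i hv
  -- Type `0` has no use for the allocation; its zero bid fixes the constant of integration.
  have h0 : s 0 = 0 := by
    refine le_antisymm ?_ (hs.nonneg i 0 (by simp))
    have := hs.best_response i 0 (by simp) 0 le_rfl
    simpa [allPayUtility] using this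
  -- Imitating the bid of another type gives the subgradient inequality for the equilibrium utility.
  have h := eq_add_integral_of_subgradient (u := fun v => v * rankRule w (cdf F v) - s v) hX
    (a := 0) (b := 1) (fun v hv v' hv' => by
      have h1 := hs.best_response i v' hv' (s v) (hs.nonneg i v hv)
      rw [allPayUtility, allPayUtility, halloc hv, halloc hv'] at h1
      linarith) hv
  rw [intervalIntegral.integral_sub intervalIntegrable_const (hX.intervalIntegrable _ _),
    intervalIntegral.integral_const, smul_eq_mul]
  simp only [h0, zero_mul, sub_zero, zero_add] at h ⊢
  linarith

end Equilibrium

/-! ### The value function -/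

section ValueFn

variable {F : Measure ℝ} [IsProbabilityMeasure F]

theorem cdf_eq_zero_of_neg (hF_supp : F (Set.Icc 0 1) = 1) {t : ℝ} (ht : t < 0) :
    cdf F t = 0 := by
  rw [cdf_eq_real]
  have h := (prob_compl_eq_zero_iff measurableSet_Icc).2 hF_supp
  have hsub : Set.Iic t ⊆ (Set.Icc (0 : ℝ) 1)ᶜ :=
    fun x hx hx' => (lt_of_le_of_lt hx ht).not_ge hx'.1
  have : F (Set.Iic t) = 0 := measure_mono_null hsub h
  simp [Measure.real, this]

theorem cdf_one_eq_one (hF_supp : F (Set.Icc 0 1) = 1) : cdf F 1 = 1 := by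
  rw [cdf_eq_real]
  have : F (Set.Iic 1) = 1 :=
    le_antisymm prob_le_one (hF_supp ▸ measure_mono fun x hx => hx.2)
  simp [Measure.real, this]

theorem bddBelow_setOf_le_cdf (hF_supp : F (Set.Icc 0 1) = 1) {q : ℝ} (hq : 0 < q) :
    BddBelow {t : ℝ | q ≤ cdf F t} := by
  refine ⟨0, fun t ht => ?_⟩
  by_contra h
  have h1 : q ≤ cdf F t := ht
  rw [cdf_eq_zero_of_neg hF_supp (not_le.1 h)] at h1
  linarith

/-- The infimum is attained because the superlevel set is closed. At `q = 0` that set is all of `ℝ`,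
hence the half-open range. -/
theorem valueFn_le_iff (hF_supp : F (Set.Icc 0 1) = 1) (hF_cont : Continuous (cdf F)) {q : ℝ}
    (hq : q ∈ Set.Ioc (0 : ℝ) 1) (t : ℝ) : valueFn F q ≤ t ↔ q ≤ cdf F t := by
  have hbdd := bddBelow_setOf_le_cdf hF_supp hq.1
  have hne : {t : ℝ | q ≤ cdf F t}.Nonempty := ⟨1, by
    show q ≤ cdf F 1
    rw [cdf_one_eq_one hF_supp]
    exact hq.2⟩
  have hclosed : IsClosed {t : ℝ | q ≤ cdf F t} := isClosed_le continuous_const hF_cont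
  constructor
  · intro h
    have h1 : q ≤ cdf F (valueFn F q) := hclosed.csInf_mem hne hbdd
    exact h1.trans (monotone_cdf F h)
  · exact fun h => csInf_le hbdd h

theorem valueFn_mem_Icc (hF_supp : F (Set.Icc 0 1) = 1) (hF_cont : Continuous (cdf F)) {q : ℝ}
    (hq : q ∈ Set.Ioc (0 : ℝ) 1) : valueFn F q ∈ Set.Icc (0 : ℝ) 1 := by
  refine ⟨?_, ?_⟩
  · by_contra h
    have h1 := (valueFn_le_iff hF_supp hF_cont hq _).1 (le_refl (valueFn F q))
    rw [cdf_eq_zero_of_neg hF_supp (not_le.1 h)] at h1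
    exact h1.not_gt hq.1
  · rw [valueFn_le_iff hF_supp hF_cont hq, cdf_one_eq_one hF_supp]
    exact hq.2

theorem cdf_valueFn (hF_supp : F (Set.Icc 0 1) = 1) (hF_cont : Continuous (cdf F)) {q : ℝ}
    (hq : q ∈ Set.Ioc (0 : ℝ) 1) : cdf F (valueFn F q) = q := by
  refine le_antisymm ?_ ((valueFn_le_iff hF_supp hF_cont hq _).1 le_rfl)
  refine le_of_tendsto (hF_cont.continuousAt.continuousWithinAt (s := Set.Iio (valueFn F q))) ?_
  filter_upwards [self_mem_nhdsWithin] with t ht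
  by_contra h
  exact ((valueFn_le_iff hF_supp hF_cont hq t).2 (not_le.1 h).le).not_gt ht

theorem monotoneOn_valueFn (hF_supp : F (Set.Icc 0 1) = 1) (hF_cont : Continuous (cdf F)) :
    MonotoneOn (valueFn F) (Set.Ioc 0 1) := by
  intro p hp q hq hpq
  rw [valueFn_le_iff hF_supp hF_cont hp, cdf_valueFn hF_supp hF_cont hq]
  exact hpq

theorem aemeasurable_valueFn (hF_supp : F (Set.Icc 0 1) = 1) (hF_cont : Continuous (cdf F)) :
    AEMeasurable (valueFn F) unif :=
  aemeasurable_restrict_of_monotoneOn measurableSet_Ioc (monotoneOn_valueFn hF_supp hF_cont)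

theorem map_valueFn (hF_supp : F (Set.Icc 0 1) = 1) (hF_cont : Continuous (cdf F)) :
    unif.map (valueFn F) = F := by
  have hm := aemeasurable_valueFn hF_supp hF_cont
  have := Measure.isProbabilityMeasure_map hm
  refine Measure.ext_of_Iic _ _ fun t => ?_
  rw [Measure.map_apply_of_aemeasurable hm measurableSet_Iic, ← ofReal_cdf]
  have hcongr : valueFn F ⁻¹' Set.Iic t =ᵐ[unif] Set.Iic (cdf F t) := by
    refine (ae_restrict_iff' measurableSet_Ioc).2 (Filter.Eventually.of_forall fun q hq => ?_)
    exact propext (valueFn_le_iff hF_supp hF_cont hq t)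
  rw [measure_congr hcongr, ← ofReal_measureReal,
    unif_real_Iic ⟨cdf_nonneg F t, cdf_le_one F t⟩]

end ValueFn

/-! ### The bid function -/

/-- The equilibrium bid function in quantile space. -/
def bidFn {n : ℕ} (F : Measure ℝ) (w : Fin (n + 1) → ℝ) (q : ℝ) : ℝ :=
  ∫ p in (0 : ℝ)..q, valueFn F p * deriv (rankRule w) p

section BidFn

variable {F : Measure ℝ} [IsProbabilityMeasure F] {n : ℕ} {w : Fin (n + 1) → ℝ}

theorem integrableOn_valueFn_mul (hF_supp : F (Set.Icc 0 1) = 1) (hF_cont : Continuous (cdf F))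
    (w : Fin (n + 1) → ℝ) :
    IntegrableOn (fun p => valueFn F p * deriv (rankRule w) p) (Set.Ioc 0 1) := by
  have h1 : Integrable (deriv (rankRule w)) (volume.restrict (Set.Ioc 0 1)) :=
    ((contDiff_deriv_rankRule w).continuous.intervalIntegrable 0 1).1
  refine h1.bdd_mul (c := 1) (aemeasurable_valueFn hF_supp hF_cont).aestronglyMeasurable ?_
  refine (ae_restrict_iff' measurableSet_Ioc).2 (Filter.Eventually.of_forall fun q hq => ?_)
  have := valueFn_mem_Icc hF_supp hF_cont hq
  rw [Real.norm_eq_abs, abs_of_nonneg this.1]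
  exact this.2

theorem intervalIntegrable_valueFn_mul (hF_supp : F (Set.Icc 0 1) = 1)
    (hF_cont : Continuous (cdf F)) (w : Fin (n + 1) → ℝ) {p q : ℝ} (hp : p ∈ Set.Icc (0 : ℝ) 1)
    (hq : q ∈ Set.Icc (0 : ℝ) 1) :
    IntervalIntegrable (fun p => valueFn F p * deriv (rankRule w) p) volume p q := by
  rw [intervalIntegrable_iff]
  exact (integrableOn_valueFn_mul hF_supp hF_cont w).mono_set
    (Set.Ioc_subset_Ioc (le_min hp.1 hq.1) (max_le hp.2 hq.2))

theorem bidFn_sub (hF_supp : F (Set.Icc 0 1) = 1) (hF_cont : Continuous (cdf F))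
    (w : Fin (n + 1) → ℝ) {p q : ℝ} (hp : p ∈ Set.Icc (0 : ℝ) 1) (hq : q ∈ Set.Icc (0 : ℝ) 1) :
    bidFn F w q - bidFn F w p = ∫ r in p..q, valueFn F r * deriv (rankRule w) r := by
  unfold bidFn
  rw [sub_eq_iff_eq_add, add_comm, intervalIntegral.integral_add_adjacent_intervals]
  · exact intervalIntegrable_valueFn_mul hF_supp hF_cont w (by simp) hp
  · exact intervalIntegrable_valueFn_mul hF_supp hF_cont w hp hq

/-- Monotonicity and the Lipschitz bound together, both from `0 ≤ v ≤ 1` in the integrand `v x'`. -/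
theorem bidFn_sub_mem (hF_supp : F (Set.Icc 0 1) = 1) (hF_cont : Continuous (cdf F))
    (hw : ∀ j, 0 ≤ w j) {L : ℝ} (hL : ∀ q ∈ Set.Ioo (0 : ℝ) 1, deriv (rankRule w) q ≤ L) {p q : ℝ}
    (hp : p ∈ Set.Icc (0 : ℝ) 1) (hq : q ∈ Set.Icc (0 : ℝ) 1) (hpq : p ≤ q) :
    bidFn F w q - bidFn F w p ∈ Set.Icc 0 (L * (q - p)) := by
  have hI : ∀ r ∈ Set.Ioo p q, r ∈ Set.Ioo (0 : ℝ) 1 :=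
    fun r hr => ⟨hp.1.trans_lt hr.1, hr.2.trans_le hq.2⟩
  have hv : ∀ r ∈ Set.Ioo p q, valueFn F r ∈ Set.Icc (0 : ℝ) 1 :=
    fun r hr => valueFn_mem_Icc hF_supp hF_cont (Set.Ioo_subset_Ioc_self (hI r hr))
  have hx : ∀ r ∈ Set.Ioo p q, 0 ≤ deriv (rankRule w) r :=
    fun r hr => deriv_rankRule_nonneg hw (Set.Ioo_subset_Icc_self (hI r hr))
  rw [bidFn_sub hF_supp hF_cont w hp hq]
  have hint := intervalIntegrable_valueFn_mul hF_supp hF_cont w hp hq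
  constructor
  · have := intervalIntegral.integral_mono_on_of_le_Ioo hpq
      (intervalIntegrable_const (c := (0 : ℝ))) hint
      fun r hr => mul_nonneg (hv r hr).1 (hx r hr)
    simpa using this
  · have := intervalIntegral.integral_mono_on_of_le_Ioo hpq hint
      (intervalIntegrable_const (c := L))
      fun r hr => (mul_le_of_le_one_left (hx r hr) (hv r hr).2).trans (hL r (hI r hr))
    rw [intervalIntegral.integral_const, smul_eq_mul] at this
    linarith

/-- Write `v(p)` as the length of `{t ≥ 0 | F(t) < p}` and exchange the two integrals. -/
theorem integral_valueFn_mul_eq (hF_supp : F (Set.Icc 0 1) = 1) (hF_cont : Continuous (cdf F))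
    (w : Fin (n + 1) → ℝ) {q : ℝ} (hq : q ∈ Set.Ioc (0 : ℝ) 1) :
    bidFn F w q = ∫ t in (0 : ℝ)..(valueFn F q), (rankRule w q - rankRule w (cdf F t)) := by
  have hv0 := (valueFn_mem_Icc hF_supp hF_cont hq).1
  have hcont := (contDiff_deriv_rankRule w).continuous
  set K : ℝ → ℝ → ℝ := fun p t => {x : ℝ × ℝ | cdf F x.2 < x.1}.indicator
    (fun x => deriv (rankRule w) x.1) (p, t) with hK
  have hset : MeasurableSet {x : ℝ × ℝ | cdf F x.2 < x.1} :=
    measurableSet_lt (hF_cont.measurable.comp measurable_snd) measurable_fst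
  have hint : Integrable (Function.uncurry K)
      ((volume.restrict (Set.Ioc 0 q)).prod (volume.restrict (Set.Ioc 0 (valueFn F q)))) := by
    refine Integrable.indicator ?_ hset
    exact Integrable.comp_fst (hcont.intervalIntegrable 0 q).1 _
  have hswap := integral_integral_swap hint
  have hleft : ∀ p ∈ Set.Ioc 0 q, ∫ t in Set.Ioc 0 (valueFn F q), K p t =
      valueFn F p * deriv (rankRule w) p := by
    intro p hp
    have hp' : p ∈ Set.Ioc (0 : ℝ) 1 := ⟨hp.1, hp.2.trans hq.2⟩
    have hlt : ∀ t, cdf F t < p ↔ t < valueFn F p := fun t => by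
      rw [← not_le, ← valueFn_le_iff hF_supp hF_cont hp', not_le]
    have : ∀ t, K p t = (Set.Iio (valueFn F p)).indicator (fun _ => deriv (rankRule w) p) t := by
      intro t
      simp [hK, Set.indicator_apply, hlt]
    simp_rw [this]
    rw [setIntegral_indicator measurableSet_Iio, setIntegral_const, smul_eq_mul]
    congr 1
    have hle : valueFn F p ≤ valueFn F q := monotoneOn_valueFn hF_supp hF_cont hp' hq hp.2
    have hset : Set.Ioc 0 (valueFn F q) ∩ Set.Iio (valueFn F p) = Set.Ioo 0 (valueFn F p) := by
      ext t
      simp only [Set.mem_inter_iff, Set.mem_Ioc, Set.mem_Iio, Set.mem_Ioo]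
      grind
    rw [hset, Real.volume_real_Ioo_of_le (valueFn_mem_Icc hF_supp hF_cont hp').1, sub_zero]
  have hright : ∀ t ∈ Set.Ioc 0 (valueFn F q), ∫ p in Set.Ioc 0 q, K p t =
      rankRule w q - rankRule w (cdf F t) := by
    intro t ht
    have hle : cdf F t ≤ q := by
      rw [← cdf_valueFn hF_supp hF_cont hq]
      exact monotone_cdf F ht.2
    have : ∀ p, K p t = (Set.Ioi (cdf F t)).indicator (deriv (rankRule w)) p := by
      intro p
      simp [hK, Set.indicator_apply]
    simp_rw [this]
    rw [setIntegral_indicator measurableSet_Ioi]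
    have hset : Set.Ioc 0 q ∩ Set.Ioi (cdf F t) = Set.Ioc (cdf F t) q := by
      have := cdf_nonneg F t
      ext p
      simp only [Set.mem_inter_iff, Set.mem_Ioc, Set.mem_Ioi]
      grind
    rw [hset, ← intervalIntegral.integral_of_le hle]
    exact intervalIntegral.integral_eq_sub_of_hasDerivAt
      (fun p _ => (hasDerivAt_rankRule w p).differentiableAt.hasDerivAt)
      (hcont.intervalIntegrable _ _)
  rw [bidFn, intervalIntegral.integral_of_le hq.1.le, intervalIntegral.integral_of_le hv0,
    ← setIntegral_congr_fun measurableSet_Ioc hleft, ← setIntegral_congr_fun measurableSet_Ioc hright]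
  exact hswap

theorem aemeasurable_bidFn (hF_supp : F (Set.Icc 0 1) = 1) (hF_cont : Continuous (cdf F))
    (w : Fin (n + 1) → ℝ) : AEMeasurable (bidFn F w) unif := by
  have h : ContinuousOn (bidFn F w) (Set.uIcc 0 1) :=
    intervalIntegral.continuousOn_primitive_interval
      (by
        rw [Set.uIcc_of_le zero_le_one, integrableOn_Icc_iff_integrableOn_Ioc]
        exact integrableOn_valueFn_mul hF_supp hF_cont w)
  rw [Set.uIcc_of_le zero_le_one] at h
  exact (h.mono Set.Ioc_subset_Icc_self).aemeasurable measurableSet_Ioc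

/-- The equilibrium bids are distributed as the bid function at a uniform quantile. -/
theorem IsAllPayBNE.map_eq {s : ℝ → ℝ} (hs : IsAllPayBNE F w fun _ : Fin n => s)
    (hF_supp : F (Set.Icc 0 1) = 1) (hF_cont : Continuous (cdf F)) (hw : ∀ j, 0 ≤ w j)
    {j : Fin (n + 1)} (hj : 1 ≤ (j : ℕ)) (hjn : (j : ℕ) < n) (hwj : 0 < w j) :
    F.map s = unif.map (bidFn F w) := by
  have hsm : Measurable s := hs.measurable ⟨0, by omega⟩
  conv_lhs => rw [← map_valueFn hF_supp hF_cont]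
  rw [AEMeasurable.map_map_of_aemeasurable hsm.aemeasurable (aemeasurable_valueFn hF_supp hF_cont)]
  refine Measure.map_congr ((ae_restrict_iff' measurableSet_Ioc).2
    (Filter.Eventually.of_forall fun q hq => ?_))
  rw [Function.comp_apply, hs.bid_eq hF_supp hF_cont hw hj hjn hwj
    (valueFn_mem_Icc hF_supp hF_cont hq), cdf_valueFn hF_supp hF_cont hq,
    integral_valueFn_mul_eq hF_supp hF_cont w hq]

/-- The revenue of the `k`-unit auction as a linear functional of the bid function. -/
theorem multiUnitRevenue_eq (hF_supp : F (Set.Icc 0 1) = 1) (hF_cont : Continuous (cdf F))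
    (hw : ∀ j, 0 ≤ w j) {j : Fin (n + 1)} (hj : 1 ≤ (j : ℕ)) (hjn : (j : ℕ) < n) (hwj : 0 < w j)
    {k : ℕ} (hjk : (j : ℕ) ≤ k) {M : ℝ} (hM : ∀ q ∈ Set.Ioo (0 : ℝ) 1, Z w k q ≤ M) :
    multiUnitRevenue F n k = ∫ q, -deriv (Z w k) q * bidFn F w q ∂unif := by
  set g : ℝ → ℝ := fun p => valueFn F p * deriv (rankRule w) p with hg
  have hgint : Integrable g unif := integrableOn_valueFn_mul hF_supp hF_cont w
  have hZint : Integrable (fun r => -deriv (Z w k) r) unif :=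
    (integrable_deriv_Z hw hj hjn hwj k hM).neg
  -- Integration by parts as Fubini on the triangle `p < r`: `valueFn` may jump, so `bidFn` need not
  -- be differentiable everywhere.
  set K : ℝ → ℝ → ℝ := fun p r => {x : ℝ × ℝ | x.1 < x.2}.indicator
    (fun x => g x.1 * -deriv (Z w k) x.2) (p, r) with hK
  have hint : Integrable (Function.uncurry K) (unif.prod unif) :=
    (hgint.mul_prod hZint).indicator (measurableSet_lt measurable_fst measurable_snd)
  have hswap := integral_integral_swap hint
  have hleft : ∀ p ∈ Set.Ioo (0 : ℝ) 1, ∫ r, K p r ∂unif =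
      revenueCurve F p * deriv (multiUnitRule n k) p := by
    intro p hp
    have h1 : ∀ r, K p r = (Set.Ioi p).indicator (fun r => g p * -deriv (Z w k) r) r := by
      intro r
      simp [hK, Set.indicator_apply]
    simp_rw [h1]
    rw [unif, setIntegral_indicator measurableSet_Ioi]
    have hset : Set.Ioc 0 1 ∩ Set.Ioi p = Set.Ioc p 1 := by
      have := hp.1
      ext r
      simp only [Set.mem_inter_iff, Set.mem_Ioc, Set.mem_Ioi]
      grind
    rw [hset, integral_const_mul, integral_neg, ← intervalIntegral.integral_of_le hp.2.le,
      integral_deriv_Z hw hj hjn hwj hjk hM hp, neg_neg, Z, revenueCurve, hg]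
    have := (deriv_rankRule_pos hw hj hjn hwj hp).ne'
    field_simp
  have hright : ∀ r ∈ Set.Ioc (0 : ℝ) 1, ∫ p, K p r ∂unif = -deriv (Z w k) r * bidFn F w r := by
    intro r hr
    have h1 : ∀ p, K p r = (Set.Iio r).indicator (fun p => g p * -deriv (Z w k) r) p := by
      intro p
      simp [hK, Set.indicator_apply]
    simp_rw [h1]
    rw [unif, setIntegral_indicator measurableSet_Iio]
    have hset : Set.Ioc 0 1 ∩ Set.Iio r = Set.Ioo 0 r := by
      have := hr.2
      ext p
      simp only [Set.mem_inter_iff, Set.mem_Ioc, Set.mem_Iio, Set.mem_Ioo]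
      grind
    rw [hset, integral_mul_const, ← integral_Ioc_eq_integral_Ioo,
      ← intervalIntegral.integral_of_le hr.1.le, bidFn, mul_comm]
  rw [multiUnitRevenue, revenue, intervalIntegral.integral_of_le zero_le_one,
    integral_Ioc_eq_integral_Ioo, ← setIntegral_congr_fun measurableSet_Ioo hleft,
    ← integral_Ioc_eq_integral_Ioo, unif, ← setIntegral_congr_fun measurableSet_Ioc hright]
  exact hswap

end BidFn

/-! ### The estimator -/

/-- Cauchy-Schwarz for the measure with density `f`, by splitting `f * g` as `√f * (√f * g)`. -/
theorem sq_lintegral_mul_le {α : Type*} [MeasurableSpace α] {μ : Measure α} {f g : α → ℝ≥0∞}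
    (hf : AEMeasurable f μ) (hg : AEMeasurable g μ) :
    (∫⁻ a, f a * g a ∂μ) ^ 2 ≤ (∫⁻ a, f a ∂μ) * ∫⁻ a, f a * g a ^ 2 ∂μ := by
  have hr : AEMeasurable (fun a => f a ^ (1 / 2 : ℝ)) μ := hf.pow_const _
  have h := ENNReal.lintegral_mul_le_Lp_mul_Lq μ
    (Real.holderConjugate_iff.2 ⟨one_lt_two, by norm_num⟩ : Real.HolderConjugate 2 2) hr (hr.mul hg)
  have hsq : ∀ x : ℝ≥0∞, (x ^ (1 / 2 : ℝ)) ^ (2 : ℝ) = x := fun x => by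
    rw [← ENNReal.rpow_mul]
    norm_num
  have hsq' : ∀ x : ℝ≥0∞, x ^ (1 / 2 : ℝ) * x ^ (1 / 2 : ℝ) = x := fun x => by
    rw [← ENNReal.rpow_add_of_nonneg _ _ (by norm_num) (by norm_num)]
    norm_num
  simp only [Pi.mul_apply, ← mul_assoc, hsq', hsq,
    ENNReal.mul_rpow_of_nonneg _ _ (by norm_num : (0 : ℝ) ≤ 2)] at h
  calc (∫⁻ a, f a * g a ∂μ) ^ 2
      ≤ ((∫⁻ a, f a ∂μ) ^ (1 / 2 : ℝ) * (∫⁻ a, f a * g a ^ (2 : ℝ) ∂μ) ^ (1 / 2 : ℝ)) ^ 2 := by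
        gcongr
    _ = (∫⁻ a, f a ∂μ) * ∫⁻ a, f a * g a ^ 2 ∂μ := by
        rw [mul_pow, sq, sq, hsq', hsq']
        simp_rw [ENNReal.rpow_two]

theorem estBid_eq_orderStat {N : ℕ} (β : Fin N → ℝ) {q : ℝ} (h : ⌊q * N⌋₊ < N) :
    estBid β q = orderStat ⟨⌊q * N⌋₊, h⟩ β := by
  rw [estBid, dif_pos h, orderStat]

theorem floor_mul_lt {N : ℕ} {q : ℝ} (hN : 1 ≤ N) (hq : q ∈ Set.Ioo (0 : ℝ) 1) :
    ⌊q * N⌋₊ < N := by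
  have hN' : (0 : ℝ) < N := by exact_mod_cast hN
  rw [Nat.floor_lt (by have := hq.1; positivity)]
  nlinarith [hq.2]

/-- Joint measurability, needed for Tonelli, follows by factoring through the countable index `⌊q *
N⌋₊`. -/
theorem measurable_estBid {N : ℕ} :
    Measurable fun x : (Fin N → ℝ) × ℝ => estBid x.1 x.2 := by
  have h : Measurable fun x : (Fin N → ℝ) × ℕ =>
      if h : x.2 < N then orderStat ⟨x.2, h⟩ x.1 else 0 := by
    refine measurable_from_prod_countable_left fun m => ?_
    by_cases hm : m < N
    · simpa only [hm, dif_pos] using measurable_orderStat ⟨m, hm⟩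
    · simp only [hm, dif_neg, not_false_eq_true, measurable_const]
  have hfloor : Measurable fun x : (Fin N → ℝ) × ℝ => (x.1, ⌊x.2 * N⌋₊) :=
    measurable_fst.prodMk (Nat.measurable_floor.comp (measurable_snd.mul_const _))
  exact h.comp hfloor

theorem abs_estBid_le {N : ℕ} (β : Fin N → ℝ) (q : ℝ) : |estBid β q| ≤ ∑ j, |β j| := by
  unfold estBid
  split_ifs with h
  · exact Finset.single_le_sum (f := fun j => |β j|) (fun j _ => abs_nonneg _) (Finset.mem_univ _)
  · rw [abs_zero]
    exact Finset.sum_nonneg fun j _ => abs_nonneg _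

/-! ### Mean squared error bounds -/

section Error

variable {F : Measure ℝ} [IsProbabilityMeasure F] {n : ℕ} {w : Fin (n + 1) → ℝ}

/-- Mean squared error of the estimated bid function at a fixed quantile. -/
theorem lintegral_sq_estBid_sub_le (hF_supp : F (Set.Icc 0 1) = 1) (hF_cont : Continuous (cdf F))
    (hw : ∀ j, 0 ≤ w j) {L : ℝ}
    (hL : ∀ q ∈ Set.Ioo (0 : ℝ) 1, deriv (rankRule w) q ≤ L)
    {N : ℕ} (hN : 1 ≤ N) {q : ℝ} (hq : q ∈ Set.Ioo (0 : ℝ) 1) :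
    ∫⁻ β, ENNReal.ofReal ((estBid β q - bidFn F w q) ^ 2)
        ∂(Measure.pi fun _ : Fin N => unif.map (bidFn F w)) ≤
      ENNReal.ofReal (L ^ 2 / (2 * N)) := by
  have hb := aemeasurable_bidFn hF_supp hF_cont w
  have hprob := Measure.isProbabilityMeasure_map hb
  have hmono : MonotoneOn (bidFn F w) (Set.Icc 0 1) := fun x hx y hy hxy =>
    sub_nonneg.1 (bidFn_sub_mem hF_supp hF_cont hw hL hx hy hxy).1
  have hlip : ∀ x ∈ Set.Icc (0 : ℝ) 1, ∀ y ∈ Set.Icc (0 : ℝ) 1,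
      (bidFn F w x - bidFn F w y) ^ 2 ≤ L ^ 2 * (x - y) ^ 2 := by
    intro x hx y hy
    rw [← mul_pow]
    rcases le_total x y with hxy | hxy
    · have := bidFn_sub_mem hF_supp hF_cont hw hL hx hy hxy
      nlinarith [this.1, this.2]
    · have := bidFn_sub_mem hF_supp hF_cont hw hL hy hx hxy
      nlinarith [this.1, this.2]
  have hfl := floor_mul_lt hN hq
  have hmeas : Measurable fun β : Fin N → ℝ =>
      ENNReal.ofReal ((estBid β q - bidFn F w q) ^ 2) :=
    (((measurable_estBid.comp measurable_prodMk_right).sub_const _).pow_const 2).ennreal_ofReal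
  have hmap : AEMeasurable (fun (U : Fin N → ℝ) j => bidFn F w (U j))
      (Measure.pi fun _ : Fin N => unif) :=
    aemeasurable_pi_lambda _ fun j =>
      hb.comp_quasiMeasurePreserving (Measure.quasiMeasurePreserving_eval _ j)
  have hmem : ∀ᵐ U : Fin N → ℝ ∂(Measure.pi fun _ => unif), ∀ j, U j ∈ Set.Ioc (0 : ℝ) 1 := by
    refine eventually_countable_forall.2 fun j => ?_
    have h1 : ∀ᵐ t ∂unif, t ∈ Set.Ioc (0 : ℝ) 1 := ae_restrict_mem measurableSet_Ioc
    exact (measurePreserving_eval (fun _ : Fin N => unif) j).quasiMeasurePreserving.ae h1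
  -- Realize the sampled bids as `bidFn` at independent uniform quantiles.
  rw [← Measure.pi_map_pi (fun _ => hb), lintegral_map' hmeas.aemeasurable hmap]
  calc ∫⁻ U : Fin N → ℝ, ENNReal.ofReal ((estBid (fun j => bidFn F w (U j)) q - bidFn F w q) ^ 2)
          ∂(Measure.pi fun _ => unif)
      ≤ ∫⁻ U : Fin N → ℝ, ENNReal.ofReal (L ^ 2) *
          ENNReal.ofReal ((orderStat ⟨⌊q * N⌋₊, hfl⟩ U - q) ^ 2) ∂(Measure.pi fun _ => unif) := by
        refine lintegral_mono_ae ?_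
        filter_upwards [hmem] with U hU
        have hU' : ∀ j, U j ∈ Set.Icc (0 : ℝ) 1 := fun j => Set.Ioc_subset_Icc_self (hU j)
        rw [← ENNReal.ofReal_mul (sq_nonneg _), estBid_eq_orderStat _ hfl,
          orderStat_comp _ hmono hU']
        exact ENNReal.ofReal_le_ofReal (hlip _ (hU' _) q (Set.Ioo_subset_Icc_self hq))
    _ = ENNReal.ofReal (L ^ 2) * ∫⁻ U : Fin N → ℝ,
          ENNReal.ofReal ((orderStat ⟨⌊q * N⌋₊, hfl⟩ U - q) ^ 2) ∂(Measure.pi fun _ => unif) :=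
        lintegral_const_mul _
          (((measurable_orderStat _).sub_const q).pow_const 2).ennreal_ofReal
    _ ≤ ENNReal.ofReal (L ^ 2) * ENNReal.ofReal (1 / (2 * N)) := by
        have hqN : 0 ≤ q * N := mul_nonneg hq.1.le (Nat.cast_nonneg N)
        gcongr
        exact lintegral_sq_orderStat_sub_le _ (Nat.floor_le hqN) (Nat.lt_floor_add_one _).le
    _ = ENNReal.ofReal (L ^ 2 / (2 * N)) := by
        rw [← ENNReal.ofReal_mul (sq_nonneg _), mul_one_div]

/-- The squared error of the revenue estimate, bounded by the weighted squared error
of the estimated bid function. -/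
theorem sq_estRevenue_sub_le (hF_supp : F (Set.Icc 0 1) = 1) (hF_cont : Continuous (cdf F))
    (hw : ∀ j, 0 ≤ w j) {j : Fin (n + 1)} (hj : 1 ≤ (j : ℕ)) (hjn : (j : ℕ) < n) (hwj : 0 < w j)
    {k : ℕ} (hjk : (j : ℕ) ≤ k) {L : ℝ} (hL : ∀ q ∈ Set.Ioo (0 : ℝ) 1, deriv (rankRule w) q ≤ L)
    {M : ℝ} (hM : ∀ q ∈ Set.Ioo (0 : ℝ) 1, Z w k q ≤ M) {N : ℕ} (β : Fin N → ℝ) :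
    ENNReal.ofReal (|estRevenue w k β - multiUnitRevenue F n k| ^ 2) ≤
      ENNReal.ofReal (2 * M) * ∫⁻ q, ENNReal.ofReal |deriv (Z w k) q| *
        ENNReal.ofReal ((estBid β q - bidFn F w q) ^ 2) ∂unif := by
  have hb := aemeasurable_bidFn hF_supp hF_cont w
  have hZ : Integrable (fun q => -deriv (Z w k) q) unif :=
    (integrable_deriv_Z hw hj hjn hwj k hM).neg
  have hestm : Measurable (estBid β) := measurable_estBid.comp measurable_prodMk_left
  have hint1 : Integrable (fun q => -deriv (Z w k) q * estBid β q) unif :=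
    hZ.mul_bdd (c := ∑ j, |β j|) hestm.aestronglyMeasurable
      (Filter.Eventually.of_forall fun q => abs_estBid_le β q)
  have hint2 : Integrable (fun q => -deriv (Z w k) q * bidFn F w q) unif := by
    refine hZ.mul_bdd (c := L) hb.aestronglyMeasurable
      ((ae_restrict_iff' measurableSet_Ioc).2 (Filter.Eventually.of_forall fun q hq => ?_))
    have h := bidFn_sub_mem hF_supp hF_cont hw hL (p := 0) (by simp)
      (Set.Ioc_subset_Icc_self hq) hq.1.le
    have h0 : bidFn F w 0 = 0 := by simp [bidFn]
    have hL0 : 0 ≤ L := (deriv_rankRule_nonneg hw (q := 1 / 2) (by norm_num)).trans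
      (hL (1 / 2) (by norm_num))
    rw [h0, sub_zero, sub_zero] at h
    rw [Real.norm_eq_abs, abs_of_nonneg h.1]
    exact h.2.trans (mul_le_of_le_one_right hL0 hq.2)
  have hdiff : estRevenue w k β - multiUnitRevenue F n k =
      ∫ q, -deriv (Z w k) q * (estBid β q - bidFn F w q) ∂unif := by
    rw [multiUnitRevenue_eq hF_supp hF_cont hw hj hjn hwj hjk hM, estRevenue,
      intervalIntegral.integral_of_le zero_le_one]
    simp_rw [mul_sub]
    exact (integral_sub hint1 hint2).symm
  have hnorm : ENNReal.ofReal |estRevenue w k β - multiUnitRevenue F n k| ≤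
      ∫⁻ q, ENNReal.ofReal |deriv (Z w k) q| * ENNReal.ofReal |estBid β q - bidFn F w q| ∂unif := by
    rw [hdiff, ← Real.norm_eq_abs, ofReal_norm]
    refine (enorm_integral_le_lintegral_enorm _).trans (le_of_eq (lintegral_congr fun q => ?_))
    rw [← ofReal_norm, Real.norm_eq_abs, abs_mul, abs_neg, ENNReal.ofReal_mul (abs_nonneg _)]
  have hZm : AEMeasurable (fun q => ENNReal.ofReal |deriv (Z w k) q|) unif :=
    (measurable_deriv (Z w k)).norm.ennreal_ofReal.aemeasurable
  have hem : AEMeasurable (fun q => ENNReal.ofReal |estBid β q - bidFn F w q|) unif :=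
    (hestm.aemeasurable.sub hb).norm.ennreal_ofReal
  calc ENNReal.ofReal (|estRevenue w k β - multiUnitRevenue F n k| ^ 2)
      = ENNReal.ofReal |estRevenue w k β - multiUnitRevenue F n k| ^ 2 :=
        ENNReal.ofReal_pow (abs_nonneg _) 2
    _ ≤ (∫⁻ q, ENNReal.ofReal |deriv (Z w k) q| *
          ENNReal.ofReal |estBid β q - bidFn F w q| ∂unif) ^ 2 := by gcongr
    _ ≤ (∫⁻ q, ENNReal.ofReal |deriv (Z w k) q| ∂unif) *
          ∫⁻ q, ENNReal.ofReal |deriv (Z w k) q| *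
            ENNReal.ofReal |estBid β q - bidFn F w q| ^ 2 ∂unif :=
        sq_lintegral_mul_le hZm hem
    _ ≤ ENNReal.ofReal (2 * M) * ∫⁻ q, ENNReal.ofReal |deriv (Z w k) q| *
          ENNReal.ofReal ((estBid β q - bidFn F w q) ^ 2) ∂unif := by
        refine mul_le_mul' (lintegral_abs_deriv_Z_le hw hj hjn hwj k hM)
          (le_of_eq (lintegral_congr fun q => ?_))
        rw [← ENNReal.ofReal_pow (abs_nonneg _), sq_abs]

theorem rootMSE_estRevenue_le (hF_supp : F (Set.Icc 0 1) = 1) (hF_cont : Continuous (cdf F))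
    (hw : ∀ j, 0 ≤ w j) {j : Fin (n + 1)} (hj : 1 ≤ (j : ℕ)) (hjn : (j : ℕ) < n) (hwj : 0 < w j)
    {k : ℕ} (hjk : (j : ℕ) ≤ k) {s : ℝ → ℝ} (hs : IsAllPayBNE F w fun _ : Fin n => s)
    {N : ℕ} (hN : 1 ≤ N) {Ω : Type*} [MeasurableSpace Ω] {P : Measure Ω} [IsProbabilityMeasure P]
    {B : Fin N → Ω → ℝ} (hB_law : ∀ i, HasLaw (B i) (F.map s) P) (hB_indep : iIndepFun B P)
    {L : ℝ} (hL : ∀ q ∈ Set.Ioo (0 : ℝ) 1, deriv (rankRule w) q ≤ L)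
    {M : ℝ} (hM : ∀ q ∈ Set.Ioo (0 : ℝ) 1, Z w k q ≤ M) :
    rootMSE P (fun ω => estRevenue w k fun i => B i ω) (multiUnitRevenue F n k) ≤
      ENNReal.ofReal (Real.sqrt (2 / N) * L * M) := by
  have hL0 : 0 ≤ L := (deriv_rankRule_nonneg hw (q := 1 / 2) (by norm_num)).trans
    (hL (1 / 2) (by norm_num))
  have hM0 : 0 ≤ M := (Z_nonneg hw k (q := 1 / 2) (by norm_num)).trans (hM (1 / 2) (by norm_num))
  have hb := aemeasurable_bidFn hF_supp hF_cont w
  have hprob := Measure.isProbabilityMeasure_map hb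
  have hlaw := hB_indep.hasLaw_pi hB_law
  rw [hs.map_eq hF_supp hF_cont hw hj hjn hwj] at hlaw
  have hmeas : AEMeasurable (Function.uncurry fun (β : Fin N → ℝ) (q : ℝ) =>
      ENNReal.ofReal |deriv (Z w k) q| * ENNReal.ofReal ((estBid β q - bidFn F w q) ^ 2))
      ((Measure.pi fun _ : Fin N => unif.map (bidFn F w)).prod unif) := by
    have h1 : AEMeasurable (fun x : (Fin N → ℝ) × ℝ => ENNReal.ofReal |deriv (Z w k) x.2|)
        ((Measure.pi fun _ : Fin N => unif.map (bidFn F w)).prod unif) :=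
      ((measurable_deriv (Z w k)).comp measurable_snd).norm.ennreal_ofReal.aemeasurable
    have h2 : AEMeasurable
        (fun x : (Fin N → ℝ) × ℝ => ENNReal.ofReal ((estBid x.1 x.2 - bidFn F w x.2) ^ 2))
        ((Measure.pi fun _ : Fin N => unif.map (bidFn F w)).prod unif) :=
      ((measurable_estBid.aemeasurable.sub hb.comp_snd).pow_const 2).ennreal_ofReal
    exact h1.mul h2
  have hmse : ∫⁻ ω, ENNReal.ofReal
      (|estRevenue w k (fun i => B i ω) - multiUnitRevenue F n k| ^ 2) ∂P ≤
      ENNReal.ofReal ((Real.sqrt (2 / N) * L * M) ^ 2) := by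
    calc ∫⁻ ω, ENNReal.ofReal
          (|estRevenue w k (fun i => B i ω) - multiUnitRevenue F n k| ^ 2) ∂P
        ≤ ∫⁻ ω, ENNReal.ofReal (2 * M) * ∫⁻ q, ENNReal.ofReal |deriv (Z w k) q| *
            ENNReal.ofReal ((estBid (fun i => B i ω) q - bidFn F w q) ^ 2) ∂unif ∂P :=
          lintegral_mono fun ω => sq_estRevenue_sub_le hF_supp hF_cont hw hj hjn hwj hjk hL hM _
      _ = ∫⁻ β, ENNReal.ofReal (2 * M) * ∫⁻ q, ENNReal.ofReal |deriv (Z w k) q| *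
            ENNReal.ofReal ((estBid β q - bidFn F w q) ^ 2) ∂unif
            ∂(Measure.pi fun _ : Fin N => unif.map (bidFn F w)) :=
          hlaw.lintegral_comp (f := fun β => ENNReal.ofReal (2 * M) *
            ∫⁻ q, ENNReal.ofReal |deriv (Z w k) q| *
              ENNReal.ofReal ((estBid β q - bidFn F w q) ^ 2) ∂unif)
            (hmeas.lintegral_prod_right.const_mul _)
      _ = ENNReal.ofReal (2 * M) * ∫⁻ q, ∫⁻ β, ENNReal.ofReal |deriv (Z w k) q| *
            ENNReal.ofReal ((estBid β q - bidFn F w q) ^ 2)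
            ∂(Measure.pi fun _ : Fin N => unif.map (bidFn F w)) ∂unif := by
          rw [lintegral_const_mul'' _ hmeas.lintegral_prod_right, lintegral_lintegral_swap hmeas]
      _ ≤ ENNReal.ofReal (2 * M) * ∫⁻ q, ENNReal.ofReal |deriv (Z w k) q| *
            ENNReal.ofReal (L ^ 2 / (2 * N)) ∂unif := by
          gcongr ENNReal.ofReal (2 * M) * ?_
          have hmem : ∀ᵐ q ∂unif, q ∈ Set.Ioo (0 : ℝ) 1 := by
            rw [unif, ← restrict_Ioo_eq_restrict_Ioc]
            exact ae_restrict_mem measurableSet_Ioo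
          refine lintegral_mono_ae ?_
          filter_upwards [hmem] with q hq
          rw [lintegral_const_mul' _ _ ENNReal.ofReal_ne_top]
          gcongr
          exact lintegral_sq_estBid_sub_le hF_supp hF_cont hw hL hN hq
      _ ≤ ENNReal.ofReal (2 * M) * (ENNReal.ofReal (2 * M) * ENNReal.ofReal (L ^ 2 / (2 * N))) := by
          rw [lintegral_mul_const' _ _ ENNReal.ofReal_ne_top]
          gcongr
          exact lintegral_abs_deriv_Z_le hw hj hjn hwj k hM
      -- One factor `2 * M` comes from Cauchy-Schwarz, the other from integrating the uniform
      -- pointwise error against `|Z'|`.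
      _ = ENNReal.ofReal ((Real.sqrt (2 / N) * L * M) ^ 2) := by
          rw [← ENNReal.ofReal_mul (by positivity), ← ENNReal.ofReal_mul (by positivity), mul_pow,
            mul_pow, Real.sq_sqrt (by positivity)]
          congr 1
          have : (N : ℝ) ≠ 0 := by exact_mod_cast (by omega : N ≠ 0)
          field_simp
  unfold rootMSE
  calc _ ≤ (ENNReal.ofReal ((Real.sqrt (2 / N) * L * M) ^ 2)) ^ (1 / 2 : ℝ) := by gcongr
    _ = ENNReal.ofReal (Real.sqrt (2 / N) * L * M) := by
        rw [ENNReal.ofReal_rpow_of_nonneg (by positivity) (by norm_num), ← Real.sqrt_eq_rpow,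
          Real.sqrt_sq (by positivity)]

end Error

end RankAuction

end

theorem mainTheorem4
    -- values are i.i.d. from a continuous distribution `F` on `[0, 1]`
    (F : Measure ℝ) [IsProbabilityMeasure F] (hF_supp : F (Set.Icc 0 1) = 1)
    (hF_cont : Continuous (cdf F))
    -- a convex combination of the multi-unit auctions for `n` agents
    (n : ℕ) (w : Fin (n + 1) → ℝ) (hw_nonneg : ∀ j, 0 ≤ w j) (hw_sum : ∑ j, w j = 1)
    -- `1 ≤ k ≤ n`, and `Z_k(1) = 0`: some non-trivial `j`-unit auction with `j ≤ k` is used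
    (k : ℕ) (hk_pos : 1 ≤ k) (hk_le : k ≤ n)
    (hw_k : ∃ j : Fin (n + 1), 1 ≤ (j : ℕ) ∧ (j : ℕ) ≤ k ∧ (j : ℕ) < n ∧ 0 < w j)
    -- the symmetric equilibrium of the all-pay auction
    (s : ℝ → ℝ) (hs : RankAuction.IsAllPayBNE F w fun _ : Fin n => s)
    -- `N` independent samples from the equilibrium bid distribution
    (N : ℕ) (hN : 1 ≤ N) {Ω : Type*} [MeasurableSpace Ω] (P : Measure Ω) [IsProbabilityMeasure P]
    (B : Fin N → Ω → ℝ) (hB_law : ∀ i, HasLaw (B i) (F.map s) P) (hB_indep : iIndepFun B P) :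
    RankAuction.rootMSE P (fun ω => RankAuction.estRevenue w k fun i => B i ω)
        (RankAuction.multiUnitRevenue F n k) ≤
      ENNReal.ofReal (Real.sqrt (2 / N)) *
        (⨆ q ∈ Set.Ioo (0 : ℝ) 1, ENNReal.ofReal (deriv (RankAuction.rankRule w) q)) *
        (⨆ q ∈ Set.Ioo (0 : ℝ) 1,
          ENNReal.ofReal ((1 - q) * deriv (RankAuction.multiUnitRule n k) q /
            deriv (RankAuction.rankRule w) q)) := by
  obtain ⟨j, hj, hjk, hjn, hwj⟩ := hw_k
  set A : ℝ≥0∞ := ⨆ q ∈ Set.Ioo (0 : ℝ) 1, ENNReal.ofReal (deriv (RankAuction.rankRule w) q)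
    with hA
  set C : ℝ≥0∞ := ⨆ q ∈ Set.Ioo (0 : ℝ) 1,
    ENNReal.ofReal ((1 - q) * deriv (RankAuction.multiUnitRule n k) q /
      deriv (RankAuction.rankRule w) q) with hC
  have hN' : (0 : ℝ) < N := by exact_mod_cast hN
  have hleA : ∀ q ∈ Set.Ioo (0 : ℝ) 1, ENNReal.ofReal (deriv (RankAuction.rankRule w) q) ≤ A :=
    fun q hq => le_iSup₂_of_le q hq le_rfl
  have hleC : ∀ q ∈ Set.Ioo (0 : ℝ) 1, ENNReal.ofReal (RankAuction.Z w k q) ≤ C :=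
    fun q hq => le_iSup₂_of_le q hq le_rfl
  -- Since `0 * ⊤ = 0` in `ℝ≥0∞`, the other factors must be nonzero for the bound to be `⊤` when `C
  -- = ⊤`.
  have hApos : A ≠ 0 := by
    have h := RankAuction.deriv_rankRule_pos hw_nonneg hj hjn hwj (q := 1 / 2) (by norm_num)
    exact ((ENNReal.ofReal_pos.2 h).trans_le (hleA (1 / 2) (by norm_num))).ne'
  have hsqrt : ENNReal.ofReal (Real.sqrt (2 / N)) ≠ 0 :=
    (ENNReal.ofReal_pos.2 (Real.sqrt_pos.2 (by positivity))).ne'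
  by_cases hCtop : C = ⊤
  · rw [hCtop, ENNReal.mul_top (mul_ne_zero hsqrt hApos)]
    exact le_top
  -- `x'` is a polynomial, hence bounded on the compact unit interval.
  have hAtop : A ≠ ⊤ := by
    obtain ⟨L, hL⟩ := (isCompact_Icc (a := (0 : ℝ)) (b := 1)).bddAbove_image
      (RankAuction.contDiff_deriv_rankRule w).continuous.continuousOn
    refine ne_top_of_le_ne_top (ENNReal.ofReal_ne_top (r := L)) (iSup₂_le fun q hq => ?_)
    exact ENNReal.ofReal_le_ofReal (hL ⟨q, Set.Ioo_subset_Icc_self hq, rfl⟩)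
  have h := RankAuction.rootMSE_estRevenue_le hF_supp hF_cont hw_nonneg hj hjn hwj hjk hs hN
    hB_law hB_indep (fun q hq => (ENNReal.ofReal_le_iff_le_toReal hAtop).1 (hleA q hq))
    (fun q hq => (ENNReal.ofReal_le_iff_le_toReal hCtop).1 (hleC q hq))
  rwa [ENNReal.ofReal_mul (by positivity), ENNReal.ofReal_mul (by positivity),
    ENNReal.ofReal_toReal hAtop, ENNReal.ofReal_toReal hCtop] at h
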